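/- Throughout, a continuum is a (non-empty) compact connected metric space. For a continuous map $f\colon X\to X$ of a compact metric space and $x\in X$, let $\omega_f(x)$ be the set of all $y\in X$ for which there are $n_i\to\infty$ with $f^{n_i}(x)\to y$. The space $X$ has the $\omega$-FTP property if, for every continuous $f\colon X\to X$ and every $x\in X$ such that all points of $\omega_f(x)$ are periodic points of $f$, the set $\omega_f(x)$ is finite. A dendrite is a locally connected continuum containing no simple closed curve; a local dendrite is a continuum every point of which has a neighborhood that is a dendrite; a graph is a continuum that is the union of finitely many arcs, any two of which are disjoint or meet only in one or both of their end points. For a local dendrite $X$, let $B(X)$ (resp. $E(X)$) be the set of branch points (resp. end points) of $X$, i.e. of those $x\in X$ having a neighborhood $U$ that is a dendrite and for which $U\setminus\{x\}$ has more than two connected components (resp. is connected). If $X$ is a local dendrite and $B(X)$ is discrete (in the subspace topology), then $X$ has the $\omega$-FTP property. In particular: (1) every graph has the $\omega$-FTP property; (2) every dendrite $X$ with $B(X)$ discrete has the $\omega$-FTP property; (3) if $X$ is a dendrite with $E(X)$ closed, then $B(X)$ is discrete and $X$ has the $\omega$-FTP property. -/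

import Mathlib

open Set Filter Topology

namespace OmegaFTP

/-- The ω-limit set of the point `x` under `f`: the limits of the sequences `f^[nᵢ] x` with
`nᵢ → ∞`. -/
def omegaLimitSet {X : Type*} [TopologicalSpace X] (f : X → X) (x : X) : Set X :=
  omegaLimit atTop (fun (n : ℕ) (y : X) => f^[n] y) {x}

/-- The ω-FTP property: for every continuous self-map, every ω-limit set all of whose points are
periodic is finite. -/
def HasOmegaFTP (X : Type*) [TopologicalSpace X] : Prop :=
  ∀ f : X → X, Continuous f → ∀ x : X,
    omegaLimitSet f x ⊆ Function.periodicPts f → (omegaLimitSet f x).Finite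

/-- A continuum: a (non-empty) compact connected metrizable space. -/
structure IsContinuum (X : Type*) [TopologicalSpace X] : Prop where
  metrizable : TopologicalSpace.MetrizableSpace X
  compact : CompactSpace X
  connected : ConnectedSpace X

/-- A dendrite: a locally connected continuum that contains no simple closed curve. -/
structure IsDendrite (X : Type*) [TopologicalSpace X] : Prop where
  continuum : IsContinuum X
  locallyConnected : LocallyConnectedSpace X
  no_simple_closed_curve : ¬ ∃ γ : Circle → X, IsEmbedding γ

/-- A local dendrite: a continuum in which every point has a neighbourhood that is a dendrite. -/
structure IsLocalDendrite (X : Type*) [TopologicalSpace X] : Prop where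
  continuum : IsContinuum X
  exists_nhds : ∀ x : X, ∃ U ∈ 𝓝 x, IsDendrite ↥U

/-- A graph: a continuum that is the union of finitely many arcs (embedded copies `range (γ i)` of
the unit interval), any two of which meet at most in common end points. -/
structure IsGraph (X : Type*) [TopologicalSpace X] : Prop where
  continuum : IsContinuum X
  exists_arcs : ∃ (n : ℕ) (γ : Fin n → unitInterval → X),
    (∀ i, IsEmbedding (γ i)) ∧ (⋃ i, range (γ i)) = univ ∧
      ∀ i j, i ≠ j → ∀ s t, γ i s = γ j t → (s = 0 ∨ s = 1) ∧ (t = 0 ∨ t = 1)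

/-- The set `B(X)` of branch points: those `x` with a dendrite neighbourhood `U` such that
`U \ {x}` has more than two connected components. -/
def branchPoints (X : Type*) [TopologicalSpace X] : Set X :=
  {x | ∃ U ∈ 𝓝 x, IsDendrite ↥U ∧ 2 < ENat.card (ConnectedComponents ↥(U \ {x}))}

/-- The set `E(X)` of end points: those `x` with a dendrite neighbourhood `U` such that
`U \ {x}` is connected (the empty set counts as connected; it occurs as `U \ {x}` in a
connected space only if that space is a single point). -/
def endPoints (X : Type*) [TopologicalSpace X] : Set X :=
  {x | ∃ U ∈ 𝓝 x, IsDendrite ↥U ∧ IsPreconnected (U \ {x})}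

end OmegaFTP

/-! Everything is reduced to one property, `FatSubcontinua`: nondegenerate subcontinua have nonempty
interior. By `FatSubcontinua.hasOmegaFTP` it suffices on a compact space. Suppose ω is an infinite
ω-limit set of periodic points. A nondegenerate continuum C in ω on which some f^n (n > 0) is the
identity cannot exist: the orbit would enter the interior of C, hence be eventually periodic. By
Baire, some f^n is the identity on a nonempty relatively open part of ω, which therefore contains a
nonempty relatively clopen set L. The points of ω whose orbits meet L form an invariant clopen set,
and such a set is all of ω; so f^n is the identity on ω. Now ω is the union of n ω-limit sets of
f^n, each connected because it consists of fixed points, hence each at most a single point.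

Fatness is proved directly for graphs (`IsGraph.fatSubcontinua`). For local dendrites with discrete
B(X) (`IsLocalDendrite.fatSubcontinua`) a subcontinuum is shrunk into a dendrite neighbourhood
without meeting B(X); there the arc joining two of its points has interior, since a side branch
would create a branch point. The arcs come from `IsDendrite.exists_least_preconnected`, which rests
on local path connectedness and on extracting injective paths.

If E(X) is closed and branch points accumulate at a branch point b, each of them cuts off from b two
end points lying in different components; limits of these end points give fixed p, p' separated by
two different branch points in an impossible way (`IsDendrite.isDiscrete_branchPoints`,
`not_separated_twice`). -/

namespace OmegaFTP

/-! ### Local path connectedness of compact locally connected metric spaces. -/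

/-- A preconnected set is chainable: two of its points are joined by a finite chain of points of the
set with arbitrarily small steps. -/
theorem exists_chain_of_isPreconnected {X : Type*} [PseudoMetricSpace X] {S : Set X}
    (hS : IsPreconnected S) {x y : X} (hx : x ∈ S) (hy : y ∈ S) {δ : ℝ} (hδ : 0 < δ) :
    ∃ (N : ℕ) (c : ℕ → X), c 0 = x ∧ (∀ j, N ≤ j → c j = y) ∧ (∀ j, c j ∈ S) ∧
      ∀ j, dist (c j) (c (j + 1)) < δ := by
  let R : Set X := {y | ∃ (N : ℕ) (c : ℕ → X), c 0 = x ∧ (∀ j, N ≤ j → c j = y) ∧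
    (∀ j, c j ∈ S) ∧ ∀ j, dist (c j) (c (j + 1)) < δ}
  have step : ∀ u ∈ R, ∀ v ∈ S, dist u v < δ → v ∈ R := by
    rintro u ⟨N, c, h0, h1, h2, h3⟩ v hv huv
    refine ⟨N + 1, fun j => if j ≤ N then c j else v, by simpa using h0, ?_, ?_, ?_⟩
    · intro j hj
      simp [show ¬ j ≤ N by omega]
    · intro j
      by_cases hj : j ≤ N <;> simp [hj, h2, hv]
    · intro j
      rcases lt_trichotomy j N with hj | hj | hj
      · simp [hj.le, show j + 1 ≤ N by omega, h3]
      · subst hj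
        simpa [h1 j le_rfl] using huv
      · simp [show ¬ j ≤ N by omega, show ¬ j + 1 ≤ N by omega, hδ]
  have hxR : x ∈ R := ⟨0, fun _ => x, rfl, fun _ _ => rfl, fun _ => hx, fun _ => by simpa using hδ⟩
  by_contra hyR
  change y ∉ R at hyR
  -- A point of `S` common to the δ-neighbourhoods of `R` and of `S \ R` would link them by two
  -- admissible steps.
  have := hS (⋃ u ∈ R, Metric.ball u δ) (⋃ u ∈ S \ R, Metric.ball u δ)
    (isOpen_biUnion fun _ _ => Metric.isOpen_ball) (isOpen_biUnion fun _ _ => Metric.isOpen_ball)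
    (fun u hu => by
      by_cases huR : u ∈ R
      · exact Or.inl (mem_biUnion huR (Metric.mem_ball_self hδ))
      · exact Or.inr (mem_biUnion (show u ∈ S \ R from ⟨hu, huR⟩) (Metric.mem_ball_self hδ)))
    ⟨x, hx, mem_biUnion hxR (Metric.mem_ball_self hδ)⟩
    ⟨y, hy, mem_biUnion (show y ∈ S \ R from ⟨hy, hyR⟩) (Metric.mem_ball_self hδ)⟩
  obtain ⟨z, hz, hz1, hz2⟩ := this
  simp only [mem_iUnion, Metric.mem_ball, exists_prop] at hz1 hz2
  obtain ⟨u, hu, hzu⟩ := hz1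
  obtain ⟨v, hv, hzv⟩ := hz2
  exact hv.2 (step z (step u hu z hz (by rwa [dist_comm])) v hv.1 hzv)

/-- A compact locally connected metric space is uniformly locally connected. -/
theorem exists_uniform_locallyConnected {X : Type*} [MetricSpace X] [CompactSpace X]
    [LocallyConnectedSpace X] {ε : ℝ} (hε : 0 < ε) :
    ∃ δ > 0, ∀ x y : X, dist x y < δ →
      ∃ S : Set X, IsPreconnected S ∧ x ∈ S ∧ y ∈ S ∧ S ⊆ Metric.ball x ε := by
  have hball : ∀ z : X, Metric.ball z (ε / 2) ∈ 𝓝 z := fun z =>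
    Metric.ball_mem_nhds z (half_pos hε)
  obtain ⟨δ, hδ, h⟩ := lebesgue_number_lemma_of_metric (s := (univ : Set X))
    (c := fun z : X => connectedComponentIn (Metric.ball z (ε / 2)) z) isCompact_univ
    (fun z => Metric.isOpen_ball.connectedComponentIn)
    (fun z _ => mem_iUnion.2 ⟨z, mem_connectedComponentIn (Metric.mem_ball_self (half_pos hε))⟩)
  refine ⟨δ, hδ, fun x y hxy => ?_⟩
  obtain ⟨z, hz⟩ := h x (mem_univ x)
  refine ⟨_, isPreconnected_connectedComponentIn, hz (Metric.mem_ball_self hδ),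
    hz (by rwa [Metric.mem_ball, dist_comm]), fun w hw => ?_⟩
  have h1 := connectedComponentIn_subset _ _ hw
  have h2 := connectedComponentIn_subset _ _ (hz (Metric.mem_ball_self hδ))
  rw [Metric.mem_ball] at *
  calc dist w x ≤ dist w z + dist x z := dist_triangle_right _ _ _
    _ < ε := by linarith

/-- The refinement step in the construction of paths from chains of points. -/
theorem exists_refine {X : Type*} [MetricSpace X] {ε δ δ' : ℝ} (hδ' : 0 < δ')
    (h : ∀ x y : X, dist x y < δ →
      ∃ S : Set X, IsPreconnected S ∧ x ∈ S ∧ y ∈ S ∧ S ⊆ Metric.ball x ε)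
    (hε : 0 < ε)
    (m : ℕ) (c : ℕ → X) (hc : ∀ k < m, dist (c k) (c (k + 1)) < δ) :
    ∃ (N : ℕ) (c' : ℕ → X), 0 < N ∧ c' 0 = c 0 ∧ c' (m * N) = c m ∧
      (∀ k < m * N, dist (c' k) (c' (k + 1)) < δ') ∧ ∀ k ≤ m * N, dist (c' k) (c (k / N)) ≤ ε := by
  have H : ∀ k, ∃ (N : ℕ) (d : ℕ → X), d 0 = c k ∧ (k < m → (∀ j, N ≤ j → d j = c (k + 1)) ∧
      (∀ j, d j ∈ Metric.ball (c k) ε) ∧ ∀ j, dist (d j) (d (j + 1)) < δ') := by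
    intro k
    by_cases hk : k < m
    · obtain ⟨S, hS, hx, hy, hSb⟩ := h _ _ (hc k hk)
      obtain ⟨N, d, h0, h1, h2, h3⟩ := exists_chain_of_isPreconnected hS hx hy hδ'
      exact ⟨N, d, h0, fun _ => ⟨h1, fun j => hSb (h2 j), h3⟩⟩
    · exact ⟨0, fun _ => c k, rfl, fun h => absurd h hk⟩
  choose N d h0 h1 using H
  -- The chains `d k` are eventually constant, so all can be run for the same number `M` of steps.
  -- The common length lets index `k` of the refined chain correspond to index `k / M` of the old
  -- one.
  let M := (∑ k ∈ Finset.range m, N k) + 1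
  have hM : 0 < M := Nat.succ_pos _
  have hNM : ∀ k < m, N k ≤ M := fun k hk =>
    (Finset.single_le_sum (fun _ _ => Nat.zero_le _) (Finset.mem_range.2 hk)).trans (Nat.le_succ _)
  refine ⟨M, fun k => d (k / M) (k % M), hM, by simp [h0], by simp [h0], ?_, ?_⟩
  · intro k hk
    have hkm : k / M < m := Nat.div_lt_of_lt_mul (by rwa [mul_comm])
    have hlt := Nat.mod_lt k hM
    have hdm := Nat.div_add_mod k M
    dsimp only
    by_cases hr : k % M + 1 < M
    · have e1 : (k + 1) / M = k / M := by
        rw [Nat.div_eq_iff hM, mul_comm]; omega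
      have e2 : (k + 1) % M = k % M + 1 := by
        have := Nat.div_add_mod (k + 1) M
        rw [e1] at this; omega
      rw [e1, e2]
      exact (h1 _ hkm).2.2 _
    · have hr' : k % M + 1 = M := by omega
      have e0 : k + 1 = M * (k / M + 1) := by rw [mul_add, mul_one]; omega
      have e1 : (k + 1) / M = k / M + 1 := by rw [e0, Nat.mul_div_cancel_left _ hM]
      have e2 : (k + 1) % M = 0 := by rw [e0, Nat.mul_mod_right]
      rw [e1, e2, h0, ← (h1 _ hkm).1 M (hNM _ hkm)]
      conv_lhs => rw [← hr']
      have := (h1 _ hkm).2.2 (k % M)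
      rwa [hr'] at this ⊢
  · intro k hk
    dsimp only
    rcases hk.lt_or_eq with hk | rfl
    · exact (Metric.mem_ball.1 ((h1 _ (Nat.div_lt_of_lt_mul (by rwa [mul_comm]))).2.1 _)).le
    · simp [h0, hε.le]

/-- In a complete metric space in which nearby points lie in small connected sets, nearby
points are joined by small paths. -/
theorem exists_path_mem_ball {X : Type*} [MetricSpace X] [CompleteSpace X]
    (H : ∀ ε : ℝ, 0 < ε → ∃ δ > 0, ∀ x y : X, dist x y < δ →
      ∃ S : Set X, IsPreconnected S ∧ x ∈ S ∧ y ∈ S ∧ S ⊆ Metric.ball x ε)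
    {r : ℝ} (hr : 0 < r) :
    ∃ δ > 0, ∀ x y : X, dist x y < δ → ∃ γ : Path x y, ∀ t, γ t ∈ Metric.ball x r := by
  -- The moves C/2/2^n add up to C; with C/2 for the initial two-point chain the path stays within
  -- 3C/2 < r of `x`.
  set C : ℝ := r / 3 with hC
  have hC0 : 0 < C := by positivity
  have he : ∀ n : ℕ, 0 < C / 2 / 2 ^ n := fun n => by positivity
  have H' : ∀ n : ℕ, ∃ δ > 0, δ ≤ C / 2 / 2 ^ n ∧ ∀ x y : X, dist x y < δ →
      ∃ S : Set X, IsPreconnected S ∧ x ∈ S ∧ y ∈ S ∧ S ⊆ Metric.ball x (C / 2 / 2 ^ n) := by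
    intro n
    obtain ⟨δ, hδ, h⟩ := H _ (he n)
    exact ⟨min δ (C / 2 / 2 ^ n), lt_min hδ (he n), min_le_right _ _,
      fun x y hxy => h x y (hxy.trans_le (min_le_left _ _))⟩
  choose δ hδ hδe hδS using H'
  refine ⟨δ 0, hδ 0, fun x y hxy => ?_⟩
  let T : ℕ → Type _ := fun n => {p : ℕ × (ℕ → X) // 0 < p.1 ∧ p.2 0 = x ∧ p.2 p.1 = y ∧
    ∀ k < p.1, dist (p.2 k) (p.2 (k + 1)) < δ n}
  have step : ∀ n (p : T n), ∃ q : T (n + 1), ∃ N : ℕ, 0 < N ∧ q.1.1 = p.1.1 * N ∧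
      ∀ k ≤ p.1.1 * N, dist (q.1.2 k) (p.1.2 (k / N)) ≤ C / 2 / 2 ^ n := by
    rintro n ⟨⟨m, c⟩, hm, h0, h1, h2⟩
    obtain ⟨N, c', hN, h0', h1', h2', h3'⟩ := exists_refine (hδ (n + 1)) (hδS n) (he n) m c h2
    exact ⟨⟨(m * N, c'), Nat.mul_pos hm hN, h0'.trans h0, h1'.trans h1, h2'⟩, N, hN, rfl, h3'⟩
  choose nxt hnxt using step
  let s : ∀ n, T n := fun n => Nat.rec (motive := T)
    ⟨(1, fun k => if k = 0 then x else y), one_pos, by simp, by simp, fun k hk => by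
      obtain rfl : k = 0 := by simpa using hk
      simpa using hxy⟩ nxt n
  have hs : ∀ n, s (n + 1) = nxt n (s n) := fun n => rfl
  -- The n-th chain traversed at constant speed, as a step function; the path is the uniform limit.
  let F : ℕ → unitInterval → X := fun n t => (s n).1.2 ⌊((s n).1.1 : ℝ) * t⌋₊
  have hfl : ∀ n (t : unitInterval), ⌊((s n).1.1 : ℝ) * t⌋₊ ≤ (s n).1.1 := fun n t =>
    Nat.floor_le_of_le (mul_le_of_le_one_right (Nat.cast_nonneg _) t.2.2)
  have hF : ∀ t n, dist (F n t) (F (n + 1) t) ≤ C / 2 / 2 ^ n := by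
    intro t n
    obtain ⟨N, hN, e, h⟩ := hnxt n (s n)
    rw [← hs] at e h
    -- At time `t` the refined chain is in the block that replaces the current step of the old
    -- chain, as ⌊mNt⌋ / N = ⌊mt⌋.
    have key : ⌊((s (n + 1)).1.1 : ℝ) * t⌋₊ / N = ⌊((s n).1.1 : ℝ) * t⌋₊ := by
      rw [← Nat.floor_div_natCast, e]
      congr 1
      push_cast
      have : (N : ℝ) ≠ 0 := by positivity
      field_simp
    have := h _ ((hfl (n + 1) t).trans_eq e)
    rwa [key, dist_comm] at this
  have hlim : ∀ t, ∃ z, Tendsto (fun n => F n t) atTop (𝓝 z) := fun t =>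
    cauchySeq_tendsto_of_complete (cauchySeq_of_le_geometric_two (hF t))
  choose f hf using hlim
  have hfd : ∀ t n, dist (F n t) (f t) ≤ C / 2 ^ n := fun t n =>
    dist_le_of_le_geometric_two_of_tendsto (hF t) (hf t) n
  have hf0 : f 0 = x := by
    refine tendsto_nhds_unique (hf 0) ?_
    have : ∀ n, F n 0 = x := fun n => by simpa [F] using (s n).2.2.1
    simp [this]
  have hf1 : f 1 = y := by
    refine tendsto_nhds_unique (hf 1) ?_
    have : ∀ n, F n 1 = y := fun n => by simpa [F] using (s n).2.2.2.1
    simp [this]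
  have hnear : ∀ n (t u : unitInterval), t ≤ u → (u : ℝ) < t + 1 / ((s n).1.1 : ℝ) →
      dist (F n t) (F n u) ≤ C / 2 ^ n := by
    intro n t u htu hut
    have hm : (0 : ℝ) < (s n).1.1 := Nat.cast_pos.2 (s n).2.1
    have ht0 : (0 : ℝ) ≤ (s n).1.1 * t := mul_nonneg hm.le t.2.1
    have h1 : ⌊((s n).1.1 : ℝ) * t⌋₊ ≤ ⌊((s n).1.1 : ℝ) * u⌋₊ :=
      Nat.floor_mono (mul_le_mul_of_nonneg_left htu hm.le)
    have h2 : ⌊((s n).1.1 : ℝ) * u⌋₊ ≤ ⌊((s n).1.1 : ℝ) * t⌋₊ + 1 := by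
      rw [← Nat.floor_add_one ht0]
      apply Nat.floor_mono
      calc ((s n).1.1 : ℝ) * u ≤ (s n).1.1 * (t + 1 / ((s n).1.1 : ℝ)) :=
            mul_le_mul_of_nonneg_left hut.le hm.le
        _ = _ := by field_simp
    have hpos : 0 ≤ C / 2 ^ n := by positivity
    have hhalf : C / 2 / 2 ^ n ≤ C / 2 ^ n := by
      gcongr; linarith
    rcases h1.eq_or_lt with h | h
    · simp only [F, h, dist_self, hpos]
    · have e : ⌊((s n).1.1 : ℝ) * u⌋₊ = ⌊((s n).1.1 : ℝ) * t⌋₊ + 1 := by omega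
      simp only [F, e]
      exact ((s n).2.2.2.2 _ (h.trans_le (hfl n u))).le.trans ((hδe n).trans hhalf)
  have hclose : ∀ n (t u : unitInterval), t ≤ u → (u : ℝ) < t + 1 / ((s n).1.1 : ℝ) →
      dist (f t) (f u) ≤ 3 * (C / 2 ^ n) := by
    intro n t u htu hut
    calc dist (f t) (f u) ≤ dist (f t) (F n t) + dist (F n t) (F n u) + dist (F n u) (f u) :=
          dist_triangle4 _ _ _ _
      _ ≤ C / 2 ^ n + C / 2 ^ n + C / 2 ^ n := by
          gcongr
          · rw [dist_comm]; exact hfd t n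
          · exact hnear n t u htu hut
          · exact hfd u n
      _ = _ := by ring
  have hcont : Continuous f := by
    rw [Metric.continuous_iff]
    intro t ε hε
    obtain ⟨n, hn⟩ : ∃ n : ℕ, 3 * (C / 2 ^ n) < ε := by
      have : Tendsto (fun n : ℕ => 3 * (C / 2 ^ n)) atTop (𝓝 (3 * 0)) := by
        refine Tendsto.const_mul 3 ?_
        exact tendsto_const_nhds.div_atTop (tendsto_pow_atTop_atTop_of_one_lt one_lt_two)
      rw [mul_zero] at this
      exact (this.eventually_lt_const hε).exists
    refine ⟨1 / ((s n).1.1 : ℝ), one_div_pos.2 (Nat.cast_pos.2 (s n).2.1), fun u hu => ?_⟩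
    rw [Subtype.dist_eq, Real.dist_eq, abs_lt] at hu
    rcases le_total t u with h | h
    · rw [dist_comm]
      exact (hclose n t u h (by linarith)).trans_lt hn
    · exact (hclose n u t h (by linarith)).trans_lt hn
  refine ⟨⟨⟨f, hcont⟩, hf0, hf1⟩, fun t => ?_⟩
  change f t ∈ _
  rw [Metric.mem_ball, dist_comm]
  have h0 : dist x (F 0 t) ≤ C / 2 := by
    have h1 : (F 0 t) = x ∨ F 0 t = y := by
      change (if ⌊((1 : ℕ) : ℝ) * t⌋₊ = 0 then x else y) = x ∨
        (if ⌊((1 : ℕ) : ℝ) * t⌋₊ = 0 then x else y) = y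
      split_ifs <;> simp
    rcases h1 with h | h <;> rw [h]
    · rw [dist_self]; positivity
    · have := hδe 0
      simp only [pow_zero, div_one] at this
      exact hxy.le.trans this
  have h1 := hfd t 0
  simp only [pow_zero, div_one] at h1
  calc dist x (f t) ≤ dist x (F 0 t) + dist (F 0 t) (f t) := dist_triangle _ _ _
    _ < r := by linarith

/-- A compact locally connected metric space is locally path connected. -/
theorem locallyPathConnectedSpace_of_compact (X : Type*) [MetricSpace X] [CompactSpace X]
    [LocallyConnectedSpace X] : LocallyPathConnectedSpace X := by
  constructor
  intro x
  refine ⟨fun s => ⟨fun hs => ?_, fun ⟨i, ⟨hi, _⟩, his⟩ => mem_of_superset hi his⟩⟩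
  obtain ⟨r, hr, hrs⟩ := Metric.mem_nhds_iff.1 hs
  obtain ⟨δ, hδ, h⟩ := exists_path_mem_ball (X := X)
    (fun ε hε => exists_uniform_locallyConnected hε) hr
  have hx : x ∈ Metric.ball x r := Metric.mem_ball_self hr
  refine ⟨pathComponentIn (Metric.ball x r) x, ⟨?_, isPathConnected_pathComponentIn hx⟩,
    pathComponentIn_subset.trans hrs⟩
  refine mem_of_superset (Metric.ball_mem_nhds x hδ) fun y hy => ?_
  obtain ⟨γ, hγ⟩ := h x y (by rwa [dist_comm])
  exact ⟨γ, hγ⟩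

/-! ### From paths to injective paths: cutting out loops and reparametrizing. -/

/-- The end points of every gap of `F` have the same image under `γ`. -/
def GapsClosedBy {X : Type*} (γ : unitInterval → X) (F : Set unitInterval) : Prop :=
  ∀ c ∈ F, ∀ d ∈ F, c < d → Disjoint (Ioo c d) F → γ c = γ d

/-- Among the closed sets containing both end points of the unit interval, all of whose gaps are
closed by `γ`, there is a minimal one. -/
theorem exists_minimal_gapsClosedBy {X : Type*} [MetricSpace X] {γ : unitInterval → X}
    (hγ : Continuous γ) :
    ∃ F : Set unitInterval, Minimal (· ∈ {F | IsClosed F ∧ 0 ∈ F ∧ 1 ∈ F ∧ GapsClosedBy γ F}) F := by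
  refine zorn_superset _ fun c hc hchain => ?_
  rcases c.eq_empty_or_nonempty with rfl | hne
  · exact ⟨univ, ⟨isClosed_univ, mem_univ _, mem_univ _, fun c _ d _ hcd h => by
      obtain ⟨z, hz⟩ := exists_between hcd
      exact absurd (mem_univ z) (disjoint_left.1 h hz)⟩, by simp⟩
  refine ⟨⋂₀ c, ⟨isClosed_sInter fun F hF => (hc hF).1, fun F hF => (hc hF).2.1,
    fun F hF => (hc hF).2.2.1, ?_⟩, fun F hF => sInter_subset_of_mem hF⟩
  intro x hx y hy hxy hdisj
  -- For a gap (x, y) of the intersection, compactness gives a member `F` of the chain missing [x',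
  -- y'], with x' near x and y' near y. The gap (u, v) of `F` around [x', y'] has x ≤ u and v ≤ y,
  -- so γ x ≈ γ u = γ v ≈ γ y.
  refine eq_of_forall_dist_le fun ε hε => ?_
  obtain ⟨η, hη, hu⟩ := Metric.uniformContinuous_iff.1
    (CompactSpace.uniformContinuous_of_continuous hγ) (ε / 2) (half_pos hε)
  obtain ⟨z, hxz, hzy⟩ := exists_between hxy
  obtain ⟨x', hxx', hx'⟩ : ∃ x', x < x' ∧ x' ≤ z ∧ dist x' x < η := by
    have h1 := (Ioc_mem_nhdsGT hxz)
    have h2 : Metric.ball x η ∈ 𝓝[>] x := mem_nhdsWithin_of_mem_nhds (Metric.ball_mem_nhds x hη)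
    have : (𝓝[>] x).NeBot := nhdsGT_neBot_of_exists_gt ⟨z, hxz⟩
    obtain ⟨w, hw1, hw2⟩ := Filter.nonempty_of_mem (inter_mem h1 h2)
    exact ⟨w, hw1.1, hw1.2, hw2⟩
  obtain ⟨y', hyy', hy'⟩ : ∃ y', y' < y ∧ z ≤ y' ∧ dist y' y < η := by
    have h1 := (Ico_mem_nhdsLT hzy)
    have h2 : Metric.ball y η ∈ 𝓝[<] y := mem_nhdsWithin_of_mem_nhds (Metric.ball_mem_nhds y hη)
    have : (𝓝[<] y).NeBot := nhdsLT_neBot_of_exists_lt ⟨z, hzy⟩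
    obtain ⟨w, hw1, hw2⟩ := Filter.nonempty_of_mem (inter_mem h1 h2)
    exact ⟨w, hw1.2, hw1.1, hw2⟩
  obtain ⟨F, hF, hFd⟩ : ∃ F ∈ c, Disjoint (Icc x' y') F := by
    by_contra! hcon
    have hnon : (⋂ F : c, Icc x' y' ∩ (F : Set unitInterval)).Nonempty := by
      have : Nonempty c := hne.to_subtype
      refine IsCompact.nonempty_iInter_of_directed_nonempty_isCompact_isClosed _ ?_ ?_ ?_ ?_
      · intro F G
        rcases hchain.total F.2 G.2 with h | h
        · exact ⟨F, subset_rfl, inter_subset_inter_right _ h⟩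
        · exact ⟨G, inter_subset_inter_right _ h, subset_rfl⟩
      · exact fun F => not_disjoint_iff_nonempty_inter.1 (hcon F F.2)
      · exact fun F => isCompact_Icc.inter_right (hc F.2).1
      · exact fun F => isClosed_Icc.inter (hc F.2).1
    obtain ⟨w, hw⟩ := hnon
    rw [mem_iInter] at hw
    obtain ⟨F0, hF0⟩ := hne
    have hwI := (hw ⟨F0, hF0⟩).1
    exact disjoint_left.1 hdisj ⟨hxx'.trans_le hwI.1, hwI.2.trans_lt hyy'⟩
      (fun F hF => (hw ⟨F, hF⟩).2)
  obtain ⟨u, ⟨huF, hux'⟩, hu1⟩ : ∃ u, IsGreatest (F ∩ Iic x') u :=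
    (((hc hF).1.inter isClosed_Iic).isCompact).exists_isGreatest ⟨x, hx F hF, hxx'.le⟩
  obtain ⟨v, ⟨hvF, hvy'⟩, hv1⟩ : ∃ v, IsLeast (F ∩ Ici y') v :=
    (((hc hF).1.inter isClosed_Ici).isCompact).exists_isLeast ⟨y, hy F hF, hyy'.le⟩
  have hx'y' : x' ≤ y' := hx'.1.trans hy'.1
  rw [mem_Iic] at hux'
  rw [mem_Ici] at hvy'
  have hux : u < x' := hux'.lt_of_ne fun h => disjoint_left.1 hFd ⟨le_rfl, hx'y'⟩ (h ▸ huF)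
  have hvy : y' < v := hvy'.lt_of_ne fun h => disjoint_left.1 hFd ⟨hx'y', le_rfl⟩ (h ▸ hvF)
  have huv : γ u = γ v := by
    refine (hc hF).2.2.2 u huF v hvF (hux.trans_le (hx'y'.trans hvy.le)) ?_
    refine disjoint_left.2 fun w hw hwF => ?_
    rcases le_total w x' with h | h
    · exact (hu1 ⟨hwF, h⟩).not_gt hw.1
    · rcases le_total w y' with h' | h'
      · exact disjoint_left.1 hFd ⟨h, h'⟩ hwF
      · exact (hv1 ⟨hwF, h'⟩).not_gt hw.2
  have hxu : x ≤ u := hu1 ⟨hx F hF, hxx'.le⟩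
  have hvy2 : v ≤ y := hv1 ⟨hy F hF, hyy'.le⟩
  have d1 : dist x u < η := by
    have := hx'.2
    rw [Subtype.dist_eq, Real.dist_eq, abs_lt] at *
    have : (x : ℝ) ≤ u := hxu
    have : (u : ℝ) < x' := hux
    constructor <;> linarith
  have d2 : dist v y < η := by
    have := hy'.2
    rw [Subtype.dist_eq, Real.dist_eq, abs_lt] at *
    have : (v : ℝ) ≤ y := hvy2
    have : (y' : ℝ) < v := hvy
    constructor <;> linarith
  have e1 := hu d1
  have e2 := hu d2
  rw [← huv] at e2
  linarith [dist_triangle (γ x) (γ u) (γ y)]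

/-- Every path can be replaced by one in the same set, with the same end points, whose fibres
are order connected. -/
theorem exists_path_ordConnected_fibres {X : Type*} [MetricSpace X] {a b : X} (γ : Path a b) :
    ∃ g : Path a b, range g ⊆ range γ ∧ ∀ x y z, x ≤ z → z ≤ y → g x = g y → g z = g x := by
  obtain ⟨F, ⟨hFc, h0, h1, hgap⟩, hmin⟩ := exists_minimal_gapsClosedBy γ.continuous
  have hmin' : ∀ x ∈ F, ∀ y ∈ F, x < y → γ x = γ y → Disjoint (Ioo x y) F := by
    intro x hx y hy hxy he
    -- Deleting the loop over (x, y) leaves an admissible set, so by minimality nothing is deleted.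
    have hsub : F ⊆ F \ Ioo x y := by
      refine hmin ⟨hFc.sdiff isOpen_Ioo, ⟨h0, fun h => (h.1.trans_le' x.2.1).false⟩,
        ⟨h1, fun h => (h.2.trans_le y.2.2).false⟩, ?_⟩ sdiff_subset
      intro c hc d hd hcd hdisj
      by_cases h : c < y ∧ x < d
      · have hcx : c = x := by
          refine le_antisymm ?_ ?_
          · by_contra! hlt
            exact hc.2 ⟨hlt, h.1⟩
          · by_contra! hlt
            exact disjoint_left.1 hdisj ⟨hlt, h.2⟩ ⟨hx, fun h => h.1.false⟩
        have hdy : d = y := by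
          refine le_antisymm ?_ ?_
          · by_contra! hlt
            exact disjoint_left.1 hdisj ⟨h.1, hlt⟩ ⟨hy, fun h => h.2.false⟩
          · by_contra! hlt
            exact hd.2 ⟨h.2, hlt⟩
        rw [hcx, hdy, he]
      · refine hgap c hc.1 d hd.1 hcd (disjoint_left.2 fun w hw hwF => ?_)
        refine disjoint_left.1 hdisj hw ⟨hwF, fun hwI => h ⟨hw.1.trans hwI.2, hwI.1.trans hw.2⟩⟩
    exact disjoint_left.2 fun w hw hwF => (hsub hwF).2 hw
  have hr : ∀ x : unitInterval, ∃ u, IsGreatest (F ∩ Iic x) u := fun x =>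
    ((hFc.inter isClosed_Iic).isCompact).exists_isGreatest ⟨0, h0, x.2.1⟩
  have hn : ∀ x : unitInterval, ∃ u, IsLeast (F ∩ Ici x) u := fun x =>
    ((hFc.inter isClosed_Ici).isCompact).exists_isLeast ⟨1, h1, x.2.2⟩
  choose r hr using hr
  choose n hn using hn
  have hrF : ∀ x, r x ∈ F := fun x => (hr x).1.1
  have hrx : ∀ x, r x ≤ x := fun x => (hr x).1.2
  have hnx : ∀ x, x ≤ n x := fun x => (hn x).1.2
  have hrn : ∀ x, γ (r x) = γ (n x) := by
    intro x
    rcases ((hrx x).trans (hnx x)).eq_or_lt with h | h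
    · rw [h]
    · refine hgap _ (hrF x) _ (hn x).1.1 h (disjoint_left.2 fun w hw hwF => ?_)
      rcases le_total w x with h' | h'
      · exact ((hr x).2 ⟨hwF, h'⟩).not_gt hw.1
      · exact ((hn x).2 ⟨hwF, h'⟩).not_gt hw.2
  have hmono : Monotone r := fun x y hxy => (hr y).2 ⟨hrF x, (hrx x).trans hxy⟩
  have hfix : ∀ x ∈ F, r x = x := fun x hx => le_antisymm (hrx x) ((hr x).2 ⟨hx, self_mem_Iic⟩)
  have hcl : ∀ {ε η : ℝ}, 0 < ε → (∀ ⦃s t⦄, dist s t < η → dist (γ s) (γ t) < ε) →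
      ∀ x y, x ≤ y → dist x y < η → dist (γ (r x)) (γ (r y)) < ε := by
    intro ε η hε h x y hxy hd
    rcases (hmono hxy).eq_or_lt with he | hlt
    · rw [he, dist_self]; exact hε
    -- The new path is γ ∘ r. If `x` and `y` round down to different points of `F`, then γ (r x) = γ
    -- (n x), and both `n x` and `r y` lie in [x, y].
    · have hxr : x < r y := by
        by_contra! hle
        exact hlt.not_ge ((hr x).2 ⟨hrF y, hle⟩)
      have hnr : n x ≤ r y := (hn x).2 ⟨hrF y, hxr.le⟩
      rw [hrn x]
      apply h
      rw [Subtype.dist_eq, Real.dist_eq, abs_lt] at *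
      have a1 : (x : ℝ) ≤ n x := hnx x
      have a2 : (n x : ℝ) ≤ r y := hnr
      have a3 : (r y : ℝ) ≤ y := hrx y
      constructor <;> linarith
  have hcont : Continuous (fun x => γ (r x)) := by
    refine UniformContinuous.continuous (Metric.uniformContinuous_iff.2 fun ε hε => ?_)
    obtain ⟨η, hη, hu⟩ := Metric.uniformContinuous_iff.1
      (CompactSpace.uniformContinuous_of_continuous γ.continuous) ε hε
    refine ⟨η, hη, fun x y hxy => ?_⟩
    rcases le_total x y with h | h
    · exact hcl hε hu x y h hxy
    · rw [dist_comm]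
      exact hcl hε hu y x h (by rwa [dist_comm])
  refine ⟨⟨⟨fun x => γ (r x), hcont⟩, by simp [hfix 0 h0], by simp [hfix 1 h1]⟩, ?_, ?_⟩
  · rintro _ ⟨x, rfl⟩
    exact mem_range_self (r x)
  · intro x y z hxz hzy he
    change γ (r x) = γ (r y) at he
    change γ (r z) = γ (r x)
    rcases ((hmono hxz).trans (hmono hzy)).eq_or_lt with h | h
    · rw [le_antisymm ((hmono hzy).trans_eq h.symm) (hmono hxz)]
    · have hd := hmin' _ (hrF x) _ (hrF y) h he
      rcases (hmono hxz).eq_or_lt with h1 | h1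
      · rw [h1]
      · rcases (hmono hzy).eq_or_lt with h2 | h2
        · rw [h2, he]
        · exact absurd (hrF z) (disjoint_left.1 hd ⟨h1, h2⟩)

/-- The maximum over `t ∈ [q, max q x]` of the distance from `g t` to `g q`. -/
noncomputable def runningMax {X : Type*} [MetricSpace X] (g : unitInterval → X)
    (q x : unitInterval) : ℝ :=
  sSup ((fun t => dist (g (max q (min t x))) (g q)) '' univ)

section runningMax

variable {X : Type*} [MetricSpace X] {g : unitInterval → X}

theorem continuous_runningMax (hg : Continuous g) (q : unitInterval) :
    Continuous (runningMax g q) :=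
  isCompact_univ.continuous_sSup (f := fun x t => dist (g (max q (min t x))) (g q))
    (by unfold Function.HasUncurry.uncurry; fun_prop)

theorem bddAbove_runningMax (hg : Continuous g) (q x : unitInterval) :
    BddAbove ((fun t => dist (g (max q (min t x))) (g q)) '' univ) :=
  (isCompact_univ.image (by fun_prop)).bddAbove

theorem le_runningMax (hg : Continuous g) {q t x : unitInterval} (hqt : q ≤ t) (htx : t ≤ x) :
    dist (g t) (g q) ≤ runningMax g q x :=
  le_csSup (bddAbove_runningMax hg q x) ⟨t, mem_univ _, by simp [htx, hqt]⟩

theorem runningMax_nonneg (hg : Continuous g) (q x : unitInterval) : 0 ≤ runningMax g q x :=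
  dist_nonneg.trans (le_csSup (bddAbove_runningMax hg q x) (mem_image_of_mem _ (mem_univ 0)))

theorem runningMax_le {q x : unitInterval} {M : ℝ} (hM : 0 ≤ M)
    (h : ∀ t, q ≤ t → t ≤ x → dist (g t) (g q) ≤ M) : runningMax g q x ≤ M := by
  refine csSup_le (image_nonempty.2 univ_nonempty) ?_
  rintro _ ⟨t, _, rfl⟩
  dsimp only
  rcases le_total q (min t x) with hq | hq
  · rw [max_eq_right hq]
    exact h _ hq (min_le_right _ _)
  · rw [max_eq_left hq, dist_self]
    exact hM

theorem monotone_runningMax (hg : Continuous g) (q : unitInterval) : Monotone (runningMax g q) :=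
  fun _ _ hxy => runningMax_le (runningMax_nonneg hg q _)
    fun _ hqt htx => le_runningMax hg hqt (htx.trans hxy)

end runningMax

/-- A path with order connected fibres has the same fibres as some continuous real function. -/
theorem exists_continuous_real_same_fibres {X : Type*} [MetricSpace X] {g : unitInterval → X}
    (hg : Continuous g) (hfib : ∀ x y z, x ≤ z → z ≤ y → g x = g y → g z = g x) :
    ∃ V : unitInterval → ℝ, Continuous V ∧ ∀ x y, V x = V y ↔ g x = g y := by
  let q : ℕ → unitInterval := TopologicalSpace.denseSeq unitInterval
  obtain ⟨C, hC⟩ := (Metric.isBounded_iff.1 (isCompact_range hg).isBounded)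
  have hC' : ∀ s t, dist (g s) (g t) ≤ C := fun s t => hC (mem_range_self s) (mem_range_self t)
  have hC0 : 0 ≤ C := dist_nonneg.trans (hC' 0 0)
  -- Each term is nondecreasing, and constant along fibres of `g`. For x < y with g x ≠ g y, a dense
  -- point q k in (x, y) with g (q k) ≠ g y makes the k-th term vanish at `x` but not at `y`.
  let u : ℕ → unitInterval → ℝ := fun k x => (1 / 2 : ℝ) ^ k * runningMax g (q k) x
  have hsum : Summable fun k : ℕ => (1 / 2 : ℝ) ^ k * C := summable_geometric_two.mul_right C
  have hle : ∀ k x, u k x ≤ (1 / 2 : ℝ) ^ k * C := fun k x =>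
    mul_le_mul_of_nonneg_left (runningMax_le hC0 fun t _ _ => hC' _ _) (by positivity)
  have hnn : ∀ k x, 0 ≤ u k x := fun k x => mul_nonneg (by positivity) (runningMax_nonneg hg _ _)
  have hs : ∀ x, Summable fun k => u k x := fun x =>
    hsum.of_nonneg_of_le (fun k => hnn k x) (fun k => hle k x)
  have hmono : ∀ k, Monotone (u k) := fun k x y hxy =>
    mul_le_mul_of_nonneg_left (monotone_runningMax hg _ hxy) (by positivity)
  have key : ∀ x y, x < y → ((∑' k, u k x) = ∑' k, u k y ↔ g x = g y) := by
    intro x y hxy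
    constructor
    · intro he
      by_contra hne
      have hopen : IsOpen ({t | g t ≠ g y} ∩ Iio y) :=
        (isOpen_ne_fun hg continuous_const).inter isOpen_Iio
      have hnb : (𝓝[>] x).NeBot := nhdsGT_neBot_of_exists_gt ⟨y, hxy⟩
      have hnonempty : (({t | g t ≠ g y} ∩ Iio y) ∩ Ioi x).Nonempty :=
        Filter.nonempty_of_mem (f := 𝓝[>] x)
          (inter_mem (mem_nhdsWithin_of_mem_nhds (hopen.mem_nhds ⟨hne, hxy⟩)) self_mem_nhdsWithin)
      obtain ⟨k, ⟨hk1, hk2⟩, hk3⟩ : ∃ k, q k ∈ ({t | g t ≠ g y} ∩ Iio y) ∩ Ioi x := by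
        obtain ⟨_, h, k, rfl⟩ := (TopologicalSpace.denseRange_denseSeq
          unitInterval).inter_open_nonempty _ (hopen.inter isOpen_Ioi) hnonempty
        exact ⟨k, h⟩
      have hlt : u k x < u k y := by
        refine mul_lt_mul_of_pos_left ?_ (by positivity)
        calc runningMax g (q k) x ≤ 0 := runningMax_le le_rfl
              fun t h1 h2 => absurd (h1.trans h2) (not_le.2 hk3)
          _ < dist (g y) (g (q k)) := dist_pos.2 (Ne.symm hk1)
          _ ≤ _ := le_runningMax hg (le_of_lt hk2) le_rfl
      exact ((hs x).tsum_lt_tsum (fun k => hmono k hxy.le) hlt (hs y)).ne he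
    · intro he
      refine tsum_congr fun k => le_antisymm (hmono k hxy.le) ?_
      refine mul_le_mul_of_nonneg_left ?_ (by positivity)
      refine runningMax_le (runningMax_nonneg hg _ _) fun t hqt hty => ?_
      rcases le_total t x with h | h
      · exact le_runningMax hg hqt h
      · rw [hfib x y t h hty he]
        rcases le_total (q k) x with h' | h'
        · exact le_runningMax hg h' le_rfl
        · rw [hfib x y (q k) h' (hqt.trans hty) he, dist_self]
          exact runningMax_nonneg hg _ _
  refine ⟨fun x => ∑' k, u k x, ?_, fun x y => ?_⟩
  · refine continuous_tsum (fun k => continuous_const.mul (continuous_runningMax hg _)) hsum ?_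
    intro k x
    rw [Real.norm_of_nonneg (hnn k x)]
    exact hle k x
  · rcases lt_trichotomy x y with h | rfl | h
    · exact key x y h
    · simp
    · rw [eq_comm, key y x h, eq_comm]

/-- Two distinct points joined by a path are joined by an injective path in the same set. -/
theorem exists_injective_path {X : Type*} [MetricSpace X] {a b : X} (hab : a ≠ b) (γ : Path a b) :
    ∃ δ : Path a b, Function.Injective δ ∧ range δ ⊆ range γ := by
  obtain ⟨g, hgr, hfib⟩ := exists_path_ordConnected_fibres γ
  obtain ⟨V, hV, hVg⟩ := exists_continuous_real_same_fibres g.continuous hfib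
  have hne : V 0 ≠ V 1 := fun h => hab (by simpa using (hVg 0 1).1 h)
  let W : unitInterval → ℝ := fun x => (V x - V 0) / (V 1 - V 0)
  have hden : V 1 - V 0 ≠ 0 := sub_ne_zero.2 hne.symm
  have hW : Continuous W := by fun_prop
  have hW0 : W 0 = 0 := by simp [W]
  have hW1 : W 1 = 1 := by simp [W, hden]
  have hWg : ∀ x y, W x = W y ↔ g x = g y := fun x y => by
    rw [← hVg]
    simp only [W]
    rw [div_left_inj' hden, sub_left_inj]
  have hsurj : ∀ s : unitInterval, ∃ x, W x = s := by
    intro s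
    have := intermediate_value_univ (0 : unitInterval) 1 hW
    rw [hW0, hW1] at this
    exact this s.2
  choose σ hσ using hsurj
  -- Although the section σ need not be continuous, `g` factors through `W`, and `W` is a closed map
  -- by compactness.
  have hcont : Continuous fun s => g (σ s) := by
    rw [continuous_iff_isClosed]
    intro K hK
    have : (fun s => g (σ s)) ⁻¹' K = Subtype.val ⁻¹' (W '' (g ⁻¹' K)) := by
      ext s
      constructor
      · intro h
        exact ⟨σ s, h, hσ s⟩
      · rintro ⟨x, hx, hxs⟩
        change g (σ s) ∈ K
        rw [(hWg (σ s) x).1 ((hσ s).trans hxs.symm)]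
        exact hx
    rw [this]
    exact (((hK.preimage g.continuous).isCompact.image hW).isClosed).preimage continuous_subtype_val
  refine ⟨⟨⟨_, hcont⟩, ?_, ?_⟩, ?_, ?_⟩
  · change g (σ 0) = a
    rw [(hWg (σ 0) 0).1 ((hσ 0).trans (by simp [hW0])), g.source]
  · change g (σ 1) = b
    rw [(hWg (σ 1) 1).1 ((hσ 1).trans (by simp [hW1])), g.target]
  · intro s t hst
    have := (hWg _ _).2 hst
    rw [hσ, hσ] at this
    exact Subtype.ext this
  · rintro _ ⟨s, rfl⟩
    exact hgr (mem_range_self (σ s))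

/-! ### Simple closed curves built from paths. -/

/-- A closed curve that is injective up to its end points is an embedded circle. -/
theorem exists_isEmbedding_circle {X : Type*} [TopologicalSpace X] [T2Space X] {L : ℝ → X}
    (hL : Continuous L) (h01 : L 0 = L 1) (hinj : InjOn L (Ico 0 1)) :
    ∃ φ : Circle → X, IsEmbedding φ := by
  have hcont : Continuous (AddCircle.liftIco (1 : ℝ) 0 L) :=
    AddCircle.liftIco_zero_continuous h01 hL.continuousOn
  have hinj' : Function.Injective (AddCircle.liftIco (1 : ℝ) 0 L) := by
    intro x y hxy
    have hmem : ∀ z, ((AddCircle.equivIco (1 : ℝ) 0 z : Ico (0 : ℝ) (0 + 1)) : ℝ) ∈ Ico (0 : ℝ) 1 :=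
      fun z => by simpa using (AddCircle.equivIco (1 : ℝ) 0 z).2
    exact (AddCircle.equivIco (1 : ℝ) 0).injective (Subtype.ext (hinj (hmem x) (hmem y) hxy))
  exact ⟨_, (hcont.isClosedEmbedding hinj').isEmbedding.comp
    (AddCircle.homeomorphCircle (one_ne_zero (α := ℝ))).symm.isEmbedding⟩

/-- Two injective paths with the same end points and no other common point form a circle. -/
theorem exists_isEmbedding_circle_of_paths {X : Type*} [TopologicalSpace X] [T2Space X] {p q : X}
    (α β : Path p q) (hα : Function.Injective α) (hβ : Function.Injective β)
    (hαβ : ∀ s t, α s = β t → s = 0 ∨ s = 1) : ∃ φ : Circle → X, IsEmbedding φ := by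
  let L : ℝ → X := fun x => if x ≤ 1 / 2 then α.extend (2 * x) else β.extend (2 - 2 * x)
  have hL : Continuous L := by
    refine Continuous.if_le (by fun_prop) (by fun_prop) continuous_id continuous_const ?_
    rintro x rfl
    norm_num
  have e1 : ∀ x (h0 : 0 ≤ x) (h : x ≤ 1 / 2), L x = α ⟨2 * x, by linarith, by linarith⟩ := by
    intro x h0 h
    simp only [L, if_pos h]
    exact α.extend_apply ⟨by linarith, by linarith⟩
  have e2 : ∀ x (h0 : 1 / 2 < x) (h : x ≤ 1), L x = β ⟨2 - 2 * x, by linarith, by linarith⟩ := by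
    intro x h0 h
    simp only [L, if_neg (not_le.2 h0)]
    exact β.extend_apply ⟨by linarith, by linarith⟩
  have hcross : ∀ x y : ℝ, 0 ≤ x → x ≤ 1 / 2 → 1 / 2 < y → y < 1 → L x ≠ L y := by
    intro x y hx0 hx hy hy1 h
    rw [e1 x hx0 hx, e2 y hy hy1.le] at h
    rcases hαβ _ _ h with h' | h'
    · rw [h'] at h
      have := congrArg Subtype.val (hβ (β.source.trans (α.source.symm.trans h)))
      simp only [Icc.coe_zero] at this
      linarith
    · rw [h'] at h
      have := congrArg Subtype.val (hβ (β.target.trans (α.target.symm.trans h)))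
      simp only [Icc.coe_one] at this
      linarith
  refine exists_isEmbedding_circle hL ?_ ?_
  · rw [e1 0 le_rfl (by norm_num), e2 1 (by norm_num) le_rfl]
    have a1 : (⟨2 * 0, by norm_num, by norm_num⟩ : unitInterval) = 0 := Subtype.ext (by norm_num)
    have a2 : (⟨2 - 2 * 1, by norm_num, by norm_num⟩ : unitInterval) = 0 :=
      Subtype.ext (by norm_num)
    rw [a1, a2, α.source, β.source]
  · intro x hx y hy hxy
    rcases le_or_gt x (1 / 2) with h | h <;> rcases le_or_gt y (1 / 2) with h' | h'
    · rw [e1 x hx.1 h, e1 y hy.1 h'] at hxy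
      have := congrArg Subtype.val (hα hxy)
      simp only at this
      linarith
    · exact absurd hxy (hcross x y hx.1 h h' hy.2)
    · exact absurd hxy.symm (hcross y x hy.1 h' h hx.2)
    · rw [e2 x h hx.2.le, e2 y h' hy.2.le] at hxy
      have := congrArg Subtype.val (hβ hxy)
      simp only at this
      linarith

/-- If an injective path passes through a point that another path with the same end points
avoids, then the space contains a simple closed curve. -/
theorem exists_isEmbedding_circle_of_avoid {X : Type*} [MetricSpace X] {a b : X} (γ β : Path a b)
    (hγ : Function.Injective γ) {t₀ : unitInterval} (ht₀ : γ t₀ ∉ range β) :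
    ∃ φ : Circle → X, IsEmbedding φ := by
  -- Let `s` and `t` be the last time before and the first time after `t₀` at which γ meets β.
  -- Between them γ meets β only at its ends, and part of β closes it up to a circle.
  have hS : IsClosed (γ ⁻¹' range β) := (isCompact_range β.continuous).isClosed.preimage γ.continuous
  obtain ⟨s, ⟨hsS, hs0⟩, hs⟩ : ∃ s, IsGreatest (γ ⁻¹' range β ∩ Iic t₀) s :=
    ((hS.inter isClosed_Iic).isCompact).exists_isGreatest ⟨0, ⟨0, by simp⟩, t₀.2.1⟩
  obtain ⟨t, ⟨htS, ht0⟩, ht⟩ : ∃ t, IsLeast (γ ⁻¹' range β ∩ Ici t₀) t :=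
    ((hS.inter isClosed_Ici).isCompact).exists_isLeast ⟨1, ⟨1, by simp⟩, t₀.2.2⟩
  rw [mem_Iic] at hs0
  rw [mem_Ici] at ht0
  have hst0 : s < t₀ := hs0.lt_of_ne fun h => ht₀ (h ▸ hsS)
  have hst : (s : ℝ) < t := hst0.trans_le ht0
  have hne : γ s ≠ γ t := fun h => (hst0.trans_le ht0).ne (hγ h)
  obtain ⟨β', hβ'⟩ : ∃ β' : Path (γ s) (γ t), ∀ w, β' w ∈ range β := by
    obtain ⟨u, hu⟩ := hsS
    obtain ⟨v, hv⟩ := htS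
    exact ⟨(β.subpath u v).cast hu.symm hv.symm, fun w => mem_range_self (Icc.convexComb u v w)⟩
  obtain ⟨δ, hδ, hδr⟩ := exists_injective_path hne β'
  have hval : ∀ u : unitInterval, ((Icc.convexComb s t u : unitInterval) : ℝ) =
      (1 - u) * s + u * t := fun u => by simp
  have hcinj : Function.Injective (Icc.convexComb s t) := by
    intro u v huv
    have h := congrArg Subtype.val huv
    rw [hval, hval] at h
    have h2 : ((u : ℝ) - v) * (t - s) = 0 := by linarith
    rcases mul_eq_zero.1 h2 with h3 | h3
    · exact Subtype.ext (by linarith)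
    · linarith
  refine exists_isEmbedding_circle_of_paths (γ.subpath s t) δ (hγ.comp hcinj) hδ ?_
  intro u v huv
  have hmem : Icc.convexComb s t u ∈ γ ⁻¹' range β := by
    change (γ.subpath s t) u ∈ range β
    rw [huv]
    obtain ⟨w, hw⟩ := hδr (mem_range_self v)
    rw [← hw]
    exact hβ' w
  have hu0 := u.2.1
  have hu1 := u.2.2
  rcases le_total (Icc.convexComb s t u) t₀ with h | h
  · have h1 : ((Icc.convexComb s t u : unitInterval) : ℝ) ≤ s := hs ⟨hmem, h⟩
    rw [hval] at h1
    left
    refine Subtype.ext (le_antisymm ?_ hu0)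
    change (u : ℝ) ≤ 0
    by_contra! hpos
    nlinarith
  · have h1 : (t : ℝ) ≤ ((Icc.convexComb s t u : unitInterval) : ℝ) := ht ⟨hmem, h⟩
    rw [hval] at h1
    right
    refine Subtype.ext (le_antisymm hu1 ?_)
    change 1 ≤ (u : ℝ)
    by_contra! hpos
    nlinarith

/-! ### Arcs in dendrites and hereditary unicoherence. -/

section Dendrite

variable {X : Type*} [MetricSpace X]

/-- In a dendrite, there is a least connected set containing two given points; it is closed. -/
theorem IsDendrite.exists_least_preconnected (hX : IsDendrite X) (a b : X) :
    ∃ A : Set X, a ∈ A ∧ b ∈ A ∧ IsPreconnected A ∧ IsClosed A ∧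
      ∀ S, IsPreconnected S → a ∈ S → b ∈ S → A ⊆ S := by
  have := hX.continuum.compact
  have := hX.continuum.connected
  have := hX.locallyConnected
  have := locallyPathConnectedSpace_of_compact X
  by_cases hab : a = b
  · subst hab
    exact ⟨{a}, rfl, rfl, isPreconnected_singleton, isClosed_singleton,
      fun S _ ha _ => singleton_subset_iff.2 ha⟩
  have hpc : IsPathConnected (univ : Set X) :=
    isOpen_univ.isConnected_iff_isPathConnected.1 isConnected_univ
  obtain ⟨γ', -⟩ := hpc.joinedIn a (mem_univ a) b (mem_univ b)
  obtain ⟨γ, hγ, -⟩ := exists_injective_path hab γ'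
  refine ⟨range γ, ⟨0, γ.source⟩, ⟨1, γ.target⟩, isPreconnected_range γ.continuous,
    (isCompact_range γ.continuous).isClosed, ?_⟩
  rintro S hS ha hb _ ⟨t, rfl⟩
  by_contra ht
  -- If `S` misses γ t, then `a` and `b` share a component of the complement of γ t. That component
  -- is open, hence path connected, and yields a second path from `a` to `b` avoiding γ t.
  have hsub : S ⊆ connectedComponentIn {γ t}ᶜ a :=
    hS.subset_connectedComponentIn ha fun x hx hxt => ht (mem_singleton_iff.1 hxt ▸ hx)
  have hpc : IsPathConnected (connectedComponentIn {γ t}ᶜ a) :=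
    (isOpen_compl_singleton.connectedComponentIn).isConnected_iff_isPathConnected.1
      ⟨⟨a, hsub ha⟩, isPreconnected_connectedComponentIn⟩
  obtain ⟨β, hβ⟩ := hpc.joinedIn a (hsub ha) b (hsub hb)
  refine hX.no_simple_closed_curve (exists_isEmbedding_circle_of_avoid γ β hγ (t₀ := t) ?_)
  rintro ⟨s, hs⟩
  exact connectedComponentIn_subset _ _ (hβ s) hs

/-- Dendrites are hereditarily unicoherent. -/
theorem IsDendrite.isPreconnected_inter (hX : IsDendrite X) {S T : Set X} (hS : IsPreconnected S)
    (hT : IsPreconnected T) : IsPreconnected (S ∩ T) := by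
  refine isPreconnected_of_forall_pair fun a ha b hb => ?_
  obtain ⟨A, haA, hbA, hA, -, h⟩ := hX.exists_least_preconnected a b
  exact ⟨A, subset_inter (h S hS ha.1 hb.1) (h T hT ha.2 hb.2), haA, hbA, hA⟩

end Dendrite

/-! ### Separation and components of the complement of a point. -/

/-- No connected subset of `Y` contains both `x` and `y`. -/
def SeparatedIn {X : Type*} [TopologicalSpace X] (Y : Set X) (x y : X) : Prop :=
  ∀ S ⊆ Y, IsPreconnected S → x ∈ S → y ∉ S

section Components

variable {X : Type*} [TopologicalSpace X]

/-- A set has at least three components if and only if it has three pairwise separated points. -/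
theorem two_lt_card_connectedComponents_iff {Y : Set X} :
    2 < ENat.card (ConnectedComponents Y) ↔ ∃ x ∈ Y, ∃ y ∈ Y, ∃ z ∈ Y,
      SeparatedIn Y x y ∧ SeparatedIn Y x z ∧ SeparatedIn Y y z := by
  have hsep : ∀ x y : Y, ((x : ConnectedComponents Y) ≠ y) ↔ SeparatedIn Y (x : X) y := by
    intro x y
    rw [not_iff_comm, ConnectedComponents.coe_eq_coe']
    constructor
    · intro h
      by_contra hne
      refine h fun S hSY hS hx hy => hne ?_
      have hS' : IsPreconnected (Subtype.val ⁻¹' S : Set Y) := by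
        rw [← IsInducing.subtypeVal.isPreconnected_image, Subtype.image_preimage_coe,
          inter_eq_right.2 hSY]
        exact hS
      exact hS'.subset_connectedComponent hy hx
    · intro h hs
      exact hs (Subtype.val '' connectedComponent y) (by rintro _ ⟨z, -, rfl⟩; exact z.2)
        (isPreconnected_connectedComponent.image _ continuous_subtype_val.continuousOn)
        ⟨x, h, rfl⟩ ⟨y, mem_connectedComponent, rfl⟩
  rw [← Set.encard_univ, ← ENat.add_one_le_iff (by simp), show (2 : ℕ∞) + 1 = 3 from rfl]
  constructor
  · intro h
    obtain ⟨t, -, ht⟩ := exists_subset_encard_eq h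
    obtain ⟨x, y, z, hxy, hxz, hyz, -⟩ := encard_eq_three.1 ht
    obtain ⟨x, rfl⟩ := ConnectedComponents.surjective_coe x
    obtain ⟨y, rfl⟩ := ConnectedComponents.surjective_coe y
    obtain ⟨z, rfl⟩ := ConnectedComponents.surjective_coe z
    exact ⟨x, x.2, y, y.2, z, z.2, (hsep _ _).1 hxy, (hsep _ _).1 hxz, (hsep _ _).1 hyz⟩
  · rintro ⟨x, hx, y, hy, z, hz, hxy, hxz, hyz⟩
    let m : Y → ConnectedComponents Y := ConnectedComponents.mk
    have : ({m ⟨x, hx⟩, m ⟨y, hy⟩, m ⟨z, hz⟩} : Set (ConnectedComponents Y)).encard = 3 :=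
      encard_eq_three.2 ⟨_, _, _, (hsep _ _).2 hxy, (hsep _ _).2 hxz, (hsep _ _).2 hyz, rfl⟩
    rw [← this]
    exact encard_le_encard (subset_univ _)

/-- A point of a connected locally connected space lies in the closure of every component of its
complement. -/
theorem mem_closure_connectedComponentIn_compl [T1Space X] [PreconnectedSpace X]
    [LocallyConnectedSpace X] {c y : X} (hy : y ≠ c) :
    c ∈ closure (connectedComponentIn {c}ᶜ y) := by
  by_contra hc
  have hyP : y ∈ connectedComponentIn {c}ᶜ y := mem_connectedComponentIn hy
  have hcl : IsClosed (connectedComponentIn {c}ᶜ y) := by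
    refine isClosed_of_closure_subset ?_
    exact isPreconnected_connectedComponentIn.closure.subset_connectedComponentIn
      (subset_closure hyP) fun z hz hzc => hc (mem_singleton_iff.1 hzc ▸ hz)
  have huniv := IsClopen.eq_univ ⟨hcl, isOpen_compl_singleton.connectedComponentIn⟩ ⟨y, hyP⟩
  exact connectedComponentIn_subset {c}ᶜ y (huniv ▸ mem_univ c) rfl

/-- The complement of a component of the complement of a point is connected. -/
theorem isPreconnected_compl_connectedComponentIn [T1Space X] [PreconnectedSpace X]
    [LocallyConnectedSpace X] (c x : X) : IsPreconnected (connectedComponentIn {c}ᶜ x)ᶜ := by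
  refine isPreconnected_of_forall c fun z hz => ?_
  have hcP : c ∉ connectedComponentIn {c}ᶜ x := fun h => connectedComponentIn_subset _ _ h rfl
  by_cases hzc : z = c
  · exact ⟨{c}, singleton_subset_iff.2 hcP, rfl, hzc, isPreconnected_singleton⟩
  refine ⟨insert c (connectedComponentIn {c}ᶜ z), ?_, mem_insert _ _,
    mem_insert_of_mem _ (mem_connectedComponentIn hzc), ?_⟩
  · rintro w (rfl | hw) hwP
    · exact hcP hwP
    · rw [connectedComponentIn_eq hwP, ← connectedComponentIn_eq hw] at hz
      exact hz (mem_connectedComponentIn hzc)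
  · exact isPreconnected_connectedComponentIn.subset_closure (subset_insert _ _)
      (insert_subset (mem_closure_connectedComponentIn_compl hzc) subset_closure)

end Components

/-! ### Nondegenerate subcontinua have interior. -/

/-- In a dendrite, a nondegenerate connected set without branch points has interior. -/
theorem IsDendrite.exists_isOpen_subset {X : Type*} [MetricSpace X] (hX : IsDendrite X)
    {C : Set X} (hC : IsPreconnected C) (hnt : C.Nontrivial)
    (hB : ∀ c ∈ C, ¬ ∃ x ∈ ({c}ᶜ : Set X), ∃ y ∈ ({c}ᶜ : Set X), ∃ z ∈ ({c}ᶜ : Set X),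
      SeparatedIn {c}ᶜ x y ∧ SeparatedIn {c}ᶜ x z ∧ SeparatedIn {c}ᶜ y z) :
    ∃ O : Set X, IsOpen O ∧ O.Nonempty ∧ O ⊆ C := by
  have := hX.continuum.connected
  have := hX.locallyConnected
  obtain ⟨a, ha, b, hb, hab⟩ := hnt
  obtain ⟨A, haA, hbA, hA, hAc, hAmin⟩ := hX.exists_least_preconnected a b
  have hbetween : ∀ {a b : X} (c : X), c ≠ a → (∀ S, IsPreconnected S → a ∈ S → b ∈ S → c ∈ S) →
      c ∈ connectedComponentIn {a}ᶜ b := by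
    intro a b c hca h
    by_contra hc
    have hb : b ∉ connectedComponentIn {a}ᶜ c := by
      intro hb
      rw [← connectedComponentIn_eq hb] at hc
      exact hc (mem_connectedComponentIn hca)
    exact h _ (isPreconnected_compl_connectedComponentIn a c)
      (fun h => connectedComponentIn_subset _ _ h rfl) hb (mem_connectedComponentIn hca)
  obtain ⟨c, hcA, hcab⟩ : ∃ c ∈ A, c ∉ ({a, b} : Set X) :=
    (hA.infinite_of_nontrivial ⟨a, haA, b, hbA, hab⟩).exists_notMem_finite (toFinite _)
  simp only [mem_insert_iff, mem_singleton_iff, not_or] at hcab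
  refine ⟨connectedComponentIn {a}ᶜ b ∩ connectedComponentIn {b}ᶜ a,
    isOpen_compl_singleton.connectedComponentIn.inter isOpen_compl_singleton.connectedComponentIn,
    ⟨c, hbetween c hcab.1 fun S hS ha hb => hAmin S hS ha hb hcA,
      hbetween c hcab.2 fun S hS hb ha => hAmin S hS ha hb hcA⟩, ?_⟩
  -- The open set consists of the points on the `b`-side of `a` and the `a`-side of `b`. If such an
  -- `x` were off the arc `A`, the arcs `H` and `K` from `x` to `a` and `b` would meet on `A` in a
  -- point `e` that separates `x`, `a`, `b` pairwise.
  rintro x ⟨hxb, hxa⟩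
  refine hAmin C hC ha hb ?_
  by_contra hxA
  obtain ⟨H, hxH, haH, hH, hHc, hHmin⟩ := hX.exists_least_preconnected x a
  obtain ⟨K, hxK, hbK, hK, hKc, hKmin⟩ := hX.exists_least_preconnected x b
  obtain ⟨e, heA, heH, heK⟩ : (A ∩ (H ∩ K)).Nonempty :=
    isPreconnected_closed_iff.1 hA H K hHc hKc
      (hAmin _ (hH.union x hxH hxK hK) (Or.inl haH) (Or.inr hbK)) ⟨a, haA, haH⟩ ⟨b, hbA, hbK⟩
  have hxe : x ≠ e := fun h => hxA (h ▸ heA)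
  have hea : e ≠ a := by
    rintro rfl
    have := hKmin _ isPreconnected_connectedComponentIn hxb (mem_connectedComponentIn hab.symm) heK
    exact connectedComponentIn_subset _ _ this rfl
  have heb : e ≠ b := by
    rintro rfl
    have := hHmin _ isPreconnected_connectedComponentIn hxa (mem_connectedComponentIn hab) heH
    exact connectedComponentIn_subset _ _ this rfl
  exact hB e (hAmin C hC ha hb heA) ⟨x, hxe, a, hea.symm, b, heb.symm,
    fun S hSe hS h1 h2 => hSe (hHmin S hS h1 h2 heH) rfl,
    fun S hSe hS h1 h2 => hSe (hKmin S hS h1 h2 heK) rfl,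
    fun S hSe hS h1 h2 => hSe (hAmin S hS h1 h2 heA) rfl⟩

/-- In a compact Hausdorff space, a neighbourhood of a connected component contains a clopen
neighbourhood of it. -/
theorem exists_isClopen_of_connectedComponent_subset {Y : Type*} [TopologicalSpace Y] [T2Space Y]
    [CompactSpace Y] {y : Y} {V : Set Y} (hV : IsOpen V) (h : connectedComponent y ⊆ V) :
    ∃ L : Set Y, IsClopen L ∧ y ∈ L ∧ L ⊆ V := by
  rw [connectedComponent_eq_iInter_isClopen] at h
  have : Nonempty { s : Set Y // IsClopen s ∧ y ∈ s } := ⟨⟨univ, isClopen_univ, mem_univ y⟩⟩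
  obtain ⟨L, hL⟩ := exists_subset_nhds_of_isCompact'
    (V := fun s : { s : Set Y // IsClopen s ∧ y ∈ s } => (s : Set Y))
    (fun s t => ⟨⟨s ∩ t, s.2.1.inter t.2.1, s.2.2, t.2.2⟩, inter_subset_left, inter_subset_right⟩)
    (fun s => s.2.1.1.isCompact) (fun s => s.2.1.1) (U := V)
    (fun x hx => hV.mem_nhds (h hx))
  exact ⟨L, L.2.1, L.2.2, hL⟩

/-- Near a point of a compact set there is a nondegenerate connected subset through that point,
unless the point has small clopen neighbourhoods. -/
theorem exists_connected_or_clopen {X : Type*} [MetricSpace X] {E V : Set X} (hE : IsCompact E)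
    (hV : IsOpen V) {z : X} (hzE : z ∈ E) (hzV : z ∈ V) :
    (∃ C ⊆ E ∩ V, IsClosed C ∧ IsPreconnected C ∧ C.Nontrivial) ∨
      ∃ L ⊆ E ∩ V, z ∈ L ∧ IsClosed L ∧ IsClosed (E \ L) := by
  obtain ⟨r, hr, hrV⟩ := Metric.nhds_basis_closedBall.mem_iff.1 (hV.mem_nhds hzV)
  set K := E ∩ Metric.closedBall z r with hK
  have hKc : IsCompact K := hE.inter_right Metric.isClosed_closedBall
  have hzK : z ∈ K := ⟨hzE, Metric.mem_closedBall_self hr.le⟩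
  have hKV : K ⊆ E ∩ V := inter_subset_inter_right _ hrV
  have := isCompact_iff_compactSpace.1 hKc
  set P : Set X := Subtype.val '' connectedComponent (⟨z, hzK⟩ : K) with hP
  have hPK : P ⊆ K := by rintro _ ⟨w, -, rfl⟩; exact w.2
  have hzP : z ∈ P := ⟨⟨z, hzK⟩, mem_connectedComponent, rfl⟩
  rcases P.subsingleton_or_nontrivial with hsub | hnt
  · right
    obtain ⟨L, hL, hzL, hLV⟩ := exists_isClopen_of_connectedComponent_subset (y := (⟨z, hzK⟩ : K))
      (V := Subtype.val ⁻¹' Metric.ball z r) (Metric.isOpen_ball.preimage continuous_subtype_val)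
      (fun w hw => by
        have : (w : X) = z := hsub ⟨w, hw, rfl⟩ hzP
        simp [this, hr])
    have hcl : ∀ {M : Set K}, IsClosed M → IsClosed (Subtype.val '' M) := fun hM =>
      (hM.isCompact.image continuous_subtype_val).isClosed
    refine ⟨Subtype.val '' L, ?_, ⟨_, hzL, rfl⟩, hcl hL.1, ?_⟩
    · rintro _ ⟨w, -, rfl⟩
      exact hKV w.2
    -- `L` lies in the open ball, so being relatively clopen in `K` makes it relatively clopen in
    -- `E`.
    · have : E \ (Subtype.val '' L) = Subtype.val '' Lᶜ ∪ E \ Metric.ball z r := by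
        ext w
        constructor
        · rintro ⟨hwE, hwL⟩
          by_cases hw : w ∈ Metric.ball z r
          · exact Or.inl ⟨⟨w, hwE, Metric.ball_subset_closedBall hw⟩, fun h => hwL ⟨_, h, rfl⟩, rfl⟩
          · exact Or.inr ⟨hwE, hw⟩
        · rintro (⟨w, hw, rfl⟩ | ⟨hwE, hw⟩)
          · refine ⟨w.2.1, ?_⟩
            rintro ⟨v, hv, hvw⟩
            exact hw (Subtype.ext hvw ▸ hv)
          · refine ⟨hwE, ?_⟩
            rintro ⟨v, hv, rfl⟩
            exact hw (hLV hv)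
      rw [this]
      exact (hcl hL.compl.1).union (hE.isClosed.sdiff Metric.isOpen_ball)
  · left
    exact ⟨P, hPK.trans hKV, (isClosed_connectedComponent.isCompact.image
      continuous_subtype_val).isClosed,
      isPreconnected_connectedComponent.image _ continuous_subtype_val.continuousOn, hnt⟩

/-- A nondegenerate continuum contains small nondegenerate continua near each of its points. -/
theorem exists_small_subcontinuum {X : Type*} [MetricSpace X] [CompactSpace X] {C V : Set X}
    (hC : IsClosed C) (hCp : IsPreconnected C) (hnt : C.Nontrivial) (hV : IsOpen V)
    (hCV : (C ∩ V).Nonempty) :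
    ∃ C' ⊆ C ∩ V, IsPreconnected C' ∧ C'.Nontrivial := by
  obtain ⟨z, hzC, hzV⟩ := hCV
  obtain ⟨w, hwC, hwz⟩ := hnt.exists_ne z
  -- Removing `w` from `V` makes the clopen alternative a proper subset of `C`, contradicting
  -- connectedness.
  rcases exists_connected_or_clopen hC.isCompact (hV.inter (isOpen_compl_singleton (x := w))) hzC
    ⟨hzV, hwz.symm⟩ with ⟨C', hC', -, hp, hn⟩ | ⟨L, hL, hzL, hLc, hLc'⟩
  · exact ⟨C', fun x hx => ⟨(hC' hx).1, (hC' hx).2.1⟩, hp, hn⟩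
  · obtain ⟨x, -, hx1, hx2⟩ := isPreconnected_closed_iff.1 hCp L (C \ L) hLc hLc'
      (fun x hx => by by_cases h : x ∈ L <;> simp [h, hx]) ⟨z, hzC, hzL⟩
      ⟨w, hwC, hwC, fun h => (hL h).2.2 rfl⟩
    exact absurd hx1 hx2.2

/-- Every nondegenerate subcontinuum has nonempty interior. -/
def FatSubcontinua (X : Type*) [TopologicalSpace X] : Prop :=
  ∀ C : Set X, IsClosed C → IsPreconnected C → C.Nontrivial →
    ∃ O : Set X, IsOpen O ∧ O.Nonempty ∧ O ⊆ C

/-- In a local dendrite with discrete set of branch points, nondegenerate subcontinua have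
nonempty interior. -/
theorem IsLocalDendrite.fatSubcontinua {X : Type*} [MetricSpace X] (hX : IsLocalDendrite X)
    (hB : IsDiscrete (branchPoints X)) : FatSubcontinua X := by
  have := hX.continuum.compact
  intro C hC hCp hnt
  obtain ⟨W, hW, hCW, hWB⟩ : ∃ W : Set X, IsOpen W ∧ (C ∩ W).Nonempty ∧
      ∀ x ∈ C ∩ W, x ∉ branchPoints X := by
    by_cases h : ∃ b ∈ C, b ∈ branchPoints X
    · obtain ⟨b, hbC, hb⟩ := h
      have := hB.to_subtype
      obtain ⟨W, hW, hWb⟩ := isOpen_induced_iff.1 (isOpen_discrete {(⟨b, hb⟩ : branchPoints X)})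
      have hbW : b ∈ W := by
        have : (⟨b, hb⟩ : branchPoints X) ∈ Subtype.val ⁻¹' W := by rw [hWb]; rfl
        exact this
      refine ⟨W \ {b}, hW.sdiff isClosed_singleton, ?_, ?_⟩
      -- Only the isolated branch point `b` lies in `W`; a nondegenerate part of `C` inside `W`
      -- survives its removal.
      · obtain ⟨C', hC', -, hn⟩ := exists_small_subcontinuum hC hCp hnt hW ⟨b, hbC, hbW⟩
        obtain ⟨q, hq, hqb⟩ := hn.exists_ne b
        exact ⟨q, (hC' hq).1, (hC' hq).2, hqb⟩
      · rintro x ⟨-, hxW, hxb⟩ hx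
        have : (⟨x, hx⟩ : branchPoints X) ∈ Subtype.val ⁻¹' W := hxW
        rw [hWb] at this
        exact hxb (congrArg Subtype.val this)
    · push Not at h
      exact ⟨univ, isOpen_univ, by simpa using hnt.nonempty, fun x hx => h x hx.1⟩
  obtain ⟨q, hqC, hqW⟩ := hCW
  obtain ⟨U, hU, hUd⟩ := hX.exists_nhds q
  obtain ⟨C', hC', hC'p, hC'n⟩ := exists_small_subcontinuum hC hCp hnt
    (hW.inter (isOpen_interior (s := U))) ⟨q, hqC, hqW, mem_interior_iff_mem_nhds.2 hU⟩
  have hC'U : C' ⊆ U := fun x hx => interior_subset (hC' hx).2.2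
  have himg : ((↑) : U → X) '' (Subtype.val ⁻¹' C') = C' := by
    rw [Subtype.image_preimage_coe, inter_eq_right.2 hC'U]
  have hpre : ∀ {S : Set X}, S ⊆ U → IsPreconnected S →
      IsPreconnected (Subtype.val ⁻¹' S : Set U) := by
    intro S hSU hS
    rw [← IsInducing.subtypeVal.isPreconnected_image, Subtype.image_preimage_coe,
      inter_eq_right.2 hSU]
    exact hS
  obtain ⟨O, hO, ⟨o, ho⟩, hOC⟩ := hUd.exists_isOpen_subset (hpre hC'U hC'p)
    (nontrivial_of_image _ _ (himg.symm ▸ hC'n)) (by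
      rintro c hc ⟨x, hx, y, hy, z, hz, hxy, hxz, hyz⟩
      have hsep : ∀ {x y : U}, SeparatedIn {c}ᶜ x y → SeparatedIn (U \ {(c : X)}) (x : X) y := by
        intro x y h S hS hSp hxS hyS
        refine h (Subtype.val ⁻¹' S) ?_ (hpre (hS.trans sdiff_subset) hSp) hxS hyS
        rintro w hw rfl
        exact (hS hw).2 rfl
      have hne : ∀ {x : U}, x ∈ ({c}ᶜ : Set U) → (x : X) ∈ U \ {(c : X)} := fun {x} hx =>
        ⟨x.2, fun h => hx (Subtype.ext h)⟩
      refine hWB c ⟨(hC' hc).1, (hC' hc).2.1⟩ ⟨U, mem_interior_iff_mem_nhds.1 (hC' hc).2.2, hUd, ?_⟩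
      exact two_lt_card_connectedComponents_iff.2 ⟨x, hne hx, y, hne hy, z, hne hz, hsep hxy,
        hsep hxz, hsep hyz⟩)
  obtain ⟨O', hO', rfl⟩ := isOpen_induced_iff.1 hO
  refine ⟨O' ∩ interior U, hO'.inter isOpen_interior, ⟨o, ho, (hC' (hOC ho)).2.2⟩, ?_⟩
  rintro x ⟨hxO, hxU⟩
  have : (⟨x, interior_subset hxU⟩ : U) ∈ (Subtype.val ⁻¹' C' : Set U) := hOC hxO
  exact (hC' this).1

/-- In a graph, nondegenerate subcontinua have nonempty interior. -/
theorem IsGraph.fatSubcontinua {X : Type*} [MetricSpace X] (hX : IsGraph X) :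
    FatSubcontinua X := by
  have := hX.continuum.compact
  obtain ⟨n, γ, hγ, huniv, hmeet⟩ := hX.exists_arcs
  intro C hC hCp hnt
  -- Edges meet only at end points, so the complement of an open piece of the interior of an edge is
  -- a finite union of compact sets.
  have hopen : ∀ i, ∀ V : Set unitInterval, IsOpen V → V ⊆ Ioo 0 1 → IsOpen (γ i '' V) := by
    intro i V hV hVI
    have hcl : IsClosed ((⋃ j ∈ {j | j ≠ i}, range (γ j)) ∪ γ i '' Vᶜ) :=
      ((toFinite _).isClosed_biUnion fun j _ => (isCompact_range (hγ j).continuous).isClosed).union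
        (hV.isClosed_compl.isCompact.image (hγ i).continuous).isClosed
    have : γ i '' V = ((⋃ j ∈ {j | j ≠ i}, range (γ j)) ∪ γ i '' Vᶜ)ᶜ := by
      ext x
      constructor
      · rintro ⟨s, hs, rfl⟩ (h | ⟨t, ht, h⟩)
        · simp only [mem_iUnion, mem_range] at h
          obtain ⟨j, hj, t, ht⟩ := h
          rcases (hmeet i j (Ne.symm hj) s t ht.symm).1 with rfl | rfl
          · exact (hVI hs).1.false
          · exact (hVI hs).2.false
        · exact ht ((hγ i).injective h ▸ hs)
      · intro hx
        rw [mem_compl_iff, mem_union, not_or] at hx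
        obtain ⟨j, s, rfl⟩ := mem_iUnion.1 (huniv ▸ mem_univ x)
        by_cases hj : j = i
        · subst hj
          by_contra hs
          exact hx.2 ⟨s, fun h => hs ⟨s, h, rfl⟩, rfl⟩
        · exact absurd (mem_biUnion (show j ∈ {j | j ≠ i} from hj) (mem_range_self s)) hx.1
    rw [this]
    exact hcl.isOpen_compl
  have hfin : (⋃ i, γ i '' {0, 1}).Finite := finite_iUnion fun i => (toFinite _).image _
  obtain ⟨c, hcC, hc⟩ := (hCp.infinite_of_nontrivial hnt).exists_notMem_finite hfin
  obtain ⟨i, s, rfl⟩ := mem_iUnion.1 (huniv ▸ mem_univ c)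
  have hs0 : s ≠ 0 := fun h => hc (mem_iUnion.2 ⟨i, s, by simp [h], rfl⟩)
  have hs1 : s ≠ 1 := fun h => hc (mem_iUnion.2 ⟨i, s, by simp [h], rfl⟩)
  have hs : s ∈ Ioo (0 : unitInterval) 1 := ⟨unitInterval.pos_iff_ne_zero.2 hs0,
    unitInterval.lt_one_iff_ne_one.2 hs1⟩
  obtain ⟨C', hC', hC'p, hC'n⟩ := exists_small_subcontinuum hC hCp hnt
    (hopen i _ isOpen_Ioo subset_rfl) ⟨γ i s, hcC, s, hs, rfl⟩
  have himg : γ i '' (γ i ⁻¹' C') = C' := by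
    rw [image_preimage_eq_iff]
    exact fun x hx => image_subset_range _ _ (hC' hx).2
  have hpre : IsPreconnected (γ i ⁻¹' C') := by
    rw [← (hγ i).isInducing.isPreconnected_image, himg]
    exact hC'p
  have hord := hpre.ordConnected
  obtain ⟨u, hu, v, hv, huv⟩ := (nontrivial_of_image (γ i) _ (himg.symm ▸ hC'n)).exists_lt
  have hsub : Ioo u v ⊆ γ i ⁻¹' C' := Ioo_subset_Icc_self.trans (hord.out hu hv)
  refine ⟨γ i '' Ioo u v, hopen i _ isOpen_Ioo
    (Ioo_subset_Ioo u.2.1 v.2.2), (nonempty_Ioo.2 huv).image _, ?_⟩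
  rintro _ ⟨t, ht, rfl⟩
  exact (hC' (hsub ht)).1

/-! ### Dynamics on ω-limit sets and the ω-FTP property. -/

section Dynamics

variable {X : Type*} [MetricSpace X] {f : X → X} {x : X}

theorem mem_omegaLimitSet_iff {y : X} :
    y ∈ omegaLimitSet f x ↔ MapClusterPt y atTop fun n : ℕ => f^[n] x :=
  mem_omegaLimit_singleton_iff_mapClusterPt _ _ _ _

theorem isClosed_omegaLimitSet : IsClosed (omegaLimitSet f x) := isClosed_omegaLimit _ _ _

theorem mapsTo_omegaLimitSet (hf : Continuous f) :
    MapsTo f (omegaLimitSet f x) (omegaLimitSet f x) := by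
  intro y hy
  rw [mem_omegaLimitSet_iff] at *
  have h := hy.continuousAt_comp hf.continuousAt
  have e : f ∘ (fun n : ℕ => f^[n] x) = (fun n : ℕ => f^[n] x) ∘ fun n => n + 1 := by
    funext n
    simp [Function.iterate_succ_apply']
  rw [e] at h
  exact h.of_comp (tendsto_add_atTop_nat 1)

theorem exists_iterate_mem {O : Set X} (hO : IsOpen O) (h : (omegaLimitSet f x ∩ O).Nonempty) :
    ∃ n, f^[n] x ∈ O := by
  obtain ⟨y, hy, hyO⟩ := h
  exact ((mem_omegaLimitSet_iff.1 hy).frequently (hO.mem_nhds hyO)).exists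

/-- A proper nonempty clopen subset of an ω-limit set is not mapped into itself. -/
theorem eq_omegaLimitSet_of_mapsTo [CompactSpace X] (hf : Continuous f) {M : Set X}
    (hM : IsClosed M) (hMω : M ⊆ omegaLimitSet f x) (hN : IsClosed (omegaLimitSet f x \ M))
    (hfM : MapsTo f M M) (hne : M.Nonempty) : M = omegaLimitSet f x := by
  refine hMω.antisymm fun y hy => ?_
  by_contra hyM
  obtain ⟨U, V, hU, hV, hMU, hNV, hUV⟩ := normal_separation hM hN disjoint_sdiff_right
  -- The orbit eventually stays in U' ∪ V. From U' it moves into `U`, which is disjoint from `V`, so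
  -- it remains in U' forever and cannot return near `y`.
  set U' := U ∩ f ⁻¹' U with hU'def
  have hU' : IsOpen U' := hU.inter (hU.preimage hf)
  have hMU' : M ⊆ U' := fun z hz => ⟨hMU hz, hMU (hfM hz)⟩
  have hev : ∀ᶠ n : ℕ in atTop, f^[n] x ∈ U' ∪ V := by
    have := eventually_mapsTo_of_isOpen_of_omegaLimit_subset (f := (atTop : Filter ℕ))
      (ϕ := fun n y => f^[n] y) (s := {x}) (hU'.union hV) (fun z hz => by
        by_cases hzM : z ∈ M
        · exact Or.inl (hMU' hzM)
        · exact Or.inr (hNV ⟨hz, hzM⟩))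
    exact this.mono fun n hn => hn rfl
  obtain ⟨N, hN⟩ := eventually_atTop.1 hev
  obtain ⟨z, hz⟩ := hne
  obtain ⟨m, hmN, hm⟩ := (((mem_omegaLimitSet_iff.1 (hMω hz)).frequently
    (hU'.mem_nhds (hMU' hz))).forall_exists_of_atTop N)
  have hstay : ∀ k, f^[m + k] x ∈ U' := by
    intro k
    induction k with
    | zero => exact hm
    | succ k ih =>
      have h1 : f^[m + (k + 1)] x ∈ U := by
        rw [← add_assoc, Function.iterate_succ_apply']
        exact ih.2
      rcases hN (m + (k + 1)) (by omega) with h | h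
      · exact h
      · exact absurd h (disjoint_left.1 hUV h1)
  obtain ⟨k, hk, hkV⟩ := (((mem_omegaLimitSet_iff.1 hy).frequently
    (hV.mem_nhds (hNV ⟨hy, hyM⟩))).forall_exists_of_atTop m)
  obtain ⟨j, rfl⟩ := Nat.exists_eq_add_of_le hk
  exact disjoint_left.1 hUV (hstay j).1 hkV

/-- An ω-limit set consisting of fixed points is connected. -/
theorem isPreconnected_omegaLimitSet_of_fixed [CompactSpace X] (hf : Continuous f)
    (h : ∀ y ∈ omegaLimitSet f x, f y = y) : IsPreconnected (omegaLimitSet f x) := by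
  rw [isPreconnected_iff_subset_of_fully_disjoint_closed isClosed_omegaLimitSet]
  intro u v hu hv huv hdisj
  by_cases hne : (omegaLimitSet f x ∩ u).Nonempty
  · left
    have hdiff : omegaLimitSet f x \ (omegaLimitSet f x ∩ u) = omegaLimitSet f x ∩ v := by
      ext z
      constructor
      · rintro ⟨hz, hzu⟩
        exact ⟨hz, (huv hz).resolve_left fun h => hzu ⟨hz, h⟩⟩
      · rintro ⟨hz, hzv⟩
        exact ⟨hz, fun h => disjoint_left.1 hdisj h.2 hzv⟩
    have := eq_omegaLimitSet_of_mapsTo hf (isClosed_omegaLimitSet.inter hu) inter_subset_left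
      (hdiff ▸ isClosed_omegaLimitSet.inter hv) (fun z hz => (h z hz.1).symm ▸ hz) hne
    exact inter_eq_left.1 this
  · right
    exact fun z hz => (huv hz).resolve_left fun h => hne ⟨z, hz, h⟩

/-- The ω-limit set of an eventually periodic point is finite. -/
theorem finite_omegaLimitSet {n k : ℕ} (hn : 0 < n) (h : f^[n] (f^[k] x) = f^[k] x) :
    (omegaLimitSet f x).Finite := by
  have hfin : (range fun j : ℕ => f^[j] x).Finite := by
    refine ((finite_Iio (k + n)).image fun j => f^[j] x).subset ?_
    rintro _ ⟨j, rfl⟩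
    rcases lt_or_ge j k with hj | hj
    · exact ⟨j, by simp; omega, rfl⟩
    · refine ⟨(j - k) % n + k, ?_, ?_⟩
      · have := Nat.mod_lt (j - k) hn
        simp only [mem_Iio]
        omega
      · have hp : Function.IsPeriodicPt f n (f^[k] x) := h
        dsimp only
        rw [Function.iterate_add_apply, hp.iterate_mod_apply, ← Function.iterate_add_apply,
          Nat.sub_add_cancel hj]
  refine hfin.subset fun y hy => ?_
  by_contra hyr
  obtain ⟨m, hm⟩ := exists_iterate_mem hfin.isClosed.isOpen_compl ⟨y, hy, hyr⟩
  exact hm ⟨m, rfl⟩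

/-- An ω-limit set is the union of the ω-limit sets of the `n`-th iterate. -/
theorem omegaLimitSet_subset_iUnion {n : ℕ} (hn : 0 < n) :
    omegaLimitSet f x ⊆ ⋃ i : Fin n, omegaLimitSet f^[n] (f^[i] x) := by
  intro y hy
  by_contra hcon
  simp only [mem_iUnion, mem_omegaLimitSet_iff, mapClusterPt_iff_frequently] at hcon
  push Not at hcon
  choose s hs hsn using hcon
  have hs' : (⋂ i, s i) ∈ 𝓝 y := (iInter_mem).2 hs
  have hev : ∀ᶠ k : ℕ in atTop, ∀ i : Fin n, (f^[n])^[k] (f^[i] x) ∉ s i :=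
    eventually_all.2 fun i => hsn i
  obtain ⟨N, hN⟩ := eventually_atTop.1 hev
  obtain ⟨m, hm, hms⟩ := ((mem_omegaLimitSet_iff.1 hy).frequently hs').forall_exists_of_atTop
    (n * N)
  refine hN (m / n) ((Nat.le_div_iff_mul_le hn).2 (by rwa [mul_comm])) ⟨m % n, Nat.mod_lt _ hn⟩ ?_
  rw [← Function.iterate_mul, ← Function.iterate_add_apply]
  simp only [Nat.div_add_mod]
  exact mem_iInter.1 hms _

theorem omegaLimitSet_iterate_subset (n : ℕ) (hn : 0 < n) (i : ℕ) :
    omegaLimitSet f^[n] (f^[i] x) ⊆ omegaLimitSet f x := by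
  intro y hy
  rw [mem_omegaLimitSet_iff] at *
  have e : (fun k : ℕ => (f^[n])^[k] (f^[i] x)) = (fun n : ℕ => f^[n] x) ∘ fun k => n * k + i := by
    funext k
    simp only [Function.comp]
    rw [← Function.iterate_mul, ← Function.iterate_add_apply]
  rw [e] at hy
  exact hy.of_comp (tendsto_atTop_mono (fun k => (Nat.le_mul_of_pos_left k hn).trans
    (Nat.le_add_right _ i)) tendsto_id)

/-- A compact space whose nondegenerate subcontinua have nonempty interior has the ω-FTP
property. -/
theorem FatSubcontinua.hasOmegaFTP [CompactSpace X] (hX : FatSubcontinua X) :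
    HasOmegaFTP X := by
  intro f hf x hper
  by_contra hinf
  have hωc : IsClosed (omegaLimitSet f x) := isClosed_omegaLimitSet
  have hne : (omegaLimitSet f x).Nonempty := Set.Infinite.nonempty hinf
  have hmaps := mapsTo_omegaLimitSet (x := x) hf
  have hnofat : ∀ n : ℕ, 0 < n → ∀ C ⊆ omegaLimitSet f x, IsClosed C → IsPreconnected C →
      C.Nontrivial → (∀ y ∈ C, f^[n] y = y) → False := by
    intro n hn C hCω hC hCp hnt hfix
    obtain ⟨O, hO, ⟨o, ho⟩, hOC⟩ := hX C hC hCp hnt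
    obtain ⟨k, hk⟩ := exists_iterate_mem hO ⟨o, hCω (hOC ho), ho⟩
    exact hinf (finite_omegaLimitSet hn (hfix _ (hOC hk)))
  obtain ⟨n, hn, z, V, hV, hzω, hzV, hVfix⟩ : ∃ n, 0 < n ∧ ∃ z, ∃ V : Set X, IsOpen V ∧
      z ∈ omegaLimitSet f x ∧ z ∈ V ∧ ∀ y ∈ omegaLimitSet f x ∩ V, f^[n] y = y := by
    have := isCompact_iff_compactSpace.1 hωc.isCompact
    have := hne.to_subtype
    -- Baire's theorem on ω; the exponent is n + 1 because periods are positive.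
    obtain ⟨n, ⟨z, hz⟩, hint⟩ := nonempty_interior_of_iUnion_of_closed
      (f := fun n : ℕ => {y : omegaLimitSet f x | f^[n + 1] (y : X) = y})
      (fun n => isClosed_eq ((hf.iterate _).comp continuous_subtype_val) continuous_subtype_val)
      (by
        refine eq_univ_of_forall fun y => mem_iUnion.2 ?_
        obtain ⟨n, hn, h⟩ := hper y.2
        exact ⟨n - 1, by
          change f^[n - 1 + 1] (y : X) = y
          rw [Nat.sub_add_cancel hn]
          exact h⟩)
    obtain ⟨W, ⟨hW, hWsub⟩, hzW⟩ := hint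
    obtain ⟨V, hV, rfl⟩ := isOpen_induced_iff.1 hW
    exact ⟨n + 1, Nat.succ_pos n, z, V, hV, hz, hzW, fun y hy => hWsub (a := ⟨y, hy.1⟩) hy.2⟩
  rcases exists_connected_or_clopen hωc.isCompact hV hzω hzV with
    ⟨C, hC, hCc, hCp, hnt⟩ | ⟨L, hL, hzL, hLc, hLc'⟩
  · exact hnofat n hn C (hC.trans inter_subset_left) hCc hCp hnt fun y hy => hVfix y (hC hy)
  have hmapsn : ∀ i, MapsTo f^[i] (omegaLimitSet f x) (omegaLimitSet f x) := fun i =>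
    hmaps.iterate i
  -- By `hMmem` these are all the points of ω whose orbits meet `L`; the finitely many preimages
  -- make `M` clopen in ω.
  set M : Set X := omegaLimitSet f x ∩ ⋃ i : Fin n, f^[i] ⁻¹' L with hM
  have hMfix : ∀ y ∈ omegaLimitSet f x, ∀ i : ℕ, f^[i] y ∈ L → f^[n] y = y := by
    intro y hy i hi
    obtain ⟨p, hp, hpy⟩ := hper hy
    -- By periodicity `y` is in turn an iterate of `f^[i] y`, a point of `L`, and `f^[n]` commutes
    -- with iterates of `f`.
    have hle : i ≤ p * i := Nat.le_mul_of_pos_left _ hp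
    have h1 : f^[p * i - i] (f^[i] y) = y := by
      rw [← Function.iterate_add_apply, Nat.sub_add_cancel hle]
      exact hpy.mul_const i
    calc f^[n] y = f^[n] (f^[p * i - i] (f^[i] y)) := by rw [h1]
      _ = f^[p * i - i] (f^[n] (f^[i] y)) := by
        rw [← Function.iterate_add_apply, add_comm, Function.iterate_add_apply]
      _ = y := by rw [hVfix _ (hL hi), h1]
  have hMmem : ∀ y ∈ omegaLimitSet f x, ∀ i : ℕ, f^[i] y ∈ L → y ∈ M := by
    intro y hy i hi
    have hp : Function.IsPeriodicPt f n y := hMfix y hy i hi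
    refine ⟨hy, mem_iUnion.2 ⟨⟨i % n, Nat.mod_lt _ hn⟩, ?_⟩⟩
    change f^[i % n] y ∈ L
    rwa [hp.iterate_mod_apply]
  have hMω : M = omegaLimitSet f x := by
    refine eq_omegaLimitSet_of_mapsTo hf ?_ inter_subset_left ?_ ?_
      ⟨z, hMmem z hzω 0 hzL⟩
    · exact hωc.inter (isClosed_iUnion_of_finite fun i => hLc.preimage (hf.iterate _))
    · have : omegaLimitSet f x \ M =
          omegaLimitSet f x ∩ ⋂ i : Fin n, f^[i] ⁻¹' (omegaLimitSet f x \ L) := by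
        ext y
        constructor
        · rintro ⟨hy, hyM⟩
          exact ⟨hy, mem_iInter.2 fun i => ⟨hmapsn i hy, fun h => hyM (hMmem y hy i h)⟩⟩
        · rintro ⟨hy, h⟩
          refine ⟨hy, fun hyM => ?_⟩
          obtain ⟨i, hi⟩ := mem_iUnion.1 hyM.2
          exact (mem_iInter.1 h i).2 hi
      rw [this]
      exact hωc.inter (isClosed_iInter fun i => hLc'.preimage (hf.iterate _))
    · rintro y ⟨hy, hyL⟩
      obtain ⟨i, hi⟩ := mem_iUnion.1 hyL
      have hfix : f^[n] y = y := hMfix y hy i hi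
      -- Since `f^[n] y = y`, the point `f y` reaches `f^[i] y` after n - 1 + i steps.
      refine hMmem _ (hmaps hy) (i + (n - 1)) ?_
      rw [← Function.iterate_succ_apply, show (i + (n - 1)).succ = i + n by omega,
        Function.iterate_add_apply, hfix]
      exact hi
  have hfix : ∀ y ∈ omegaLimitSet f x, f^[n] y = y := by
    intro y hy
    rw [← hMω] at hy
    obtain ⟨i, hi⟩ := mem_iUnion.1 hy.2
    exact hMfix y hy.1 i hi
  refine hinf ((finite_iUnion fun i : Fin n => ?_).subset (omegaLimitSet_subset_iUnion hn))
  have hsub := omegaLimitSet_iterate_subset (f := f) (x := x) n hn i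
  have hconn := isPreconnected_omegaLimitSet_of_fixed (x := f^[i] x) (hf.iterate n)
    fun y hy => hfix y (hsub hy)
  rcases (omegaLimitSet f^[n] (f^[i] x)).subsingleton_or_nontrivial with h | h
  · exact h.finite
  · exact (hnofat n hn _ hsub isClosed_omegaLimitSet hconn h fun y hy => hfix y (hsub hy)).elim

end Dynamics

/-! ### Dendrites with a closed set of end points. -/

theorem IsDendrite.univ {X : Type*} [TopologicalSpace X] (hX : IsDendrite X) :
    IsDendrite (univ : Set X) := by
  have := hX.continuum.metrizable
  have := hX.continuum.compact
  have := hX.continuum.connected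
  have := hX.locallyConnected
  let e := Homeomorph.Set.univ X
  refine ⟨⟨inferInstance, e.symm.compactSpace, ?_⟩, e.locallyConnectedSpace, ?_⟩
  · exact e.symm.surjective.connectedSpace e.symm.continuous
  · rintro ⟨γ, hγ⟩
    exact hX.no_simple_closed_curve ⟨_, e.isEmbedding.comp hγ⟩

theorem IsDendrite.isLocalDendrite {X : Type*} [TopologicalSpace X] (hX : IsDendrite X) :
    IsLocalDendrite X :=
  ⟨hX.continuum, fun _ => ⟨Set.univ, univ_mem, hX.univ⟩⟩

section Components

variable {X : Type*} [TopologicalSpace X]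

theorem separatedIn_iff {Y : Set X} {x y : X} (hx : x ∈ Y) :
    SeparatedIn Y x y ↔ y ∉ connectedComponentIn Y x :=
  ⟨fun h => h _ (connectedComponentIn_subset _ _) isPreconnected_connectedComponentIn
    (mem_connectedComponentIn hx), fun h _ hSY hS hxS hyS =>
    h (hS.subset_connectedComponentIn hxS hSY hyS)⟩

/-- A connected set avoiding `e` that meets a component of the complement of `e` is contained
in it. -/
theorem subset_connectedComponentIn_compl {K : Set X} (hK : IsPreconnected K) {e y w : X}
    (he : e ∉ K) (hw : w ∈ K) (hwy : w ∈ connectedComponentIn {e}ᶜ y) :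
    K ⊆ connectedComponentIn {e}ᶜ y := by
  rw [connectedComponentIn_eq hwy]
  exact hK.subset_connectedComponentIn hw fun z hz hze => he (mem_singleton_iff.1 hze ▸ hz)

variable [T1Space X] [PreconnectedSpace X] [LocallyConnectedSpace X]

theorem closure_connectedComponentIn_compl {e y : X} (hy : y ≠ e) :
    closure (connectedComponentIn {e}ᶜ y) = insert e (connectedComponentIn {e}ᶜ y) := by
  refine Subset.antisymm (fun z hz => ?_) (insert_subset
    (mem_closure_connectedComponentIn_compl hy) subset_closure)
  by_cases hze : z = e
  · exact Or.inl hze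
  · right
    have hp : IsPreconnected (insert z (connectedComponentIn {e}ᶜ y)) :=
      isPreconnected_connectedComponentIn.subset_closure (subset_insert _ _)
        (insert_subset hz subset_closure)
    have he : e ∉ insert z (connectedComponentIn {e}ᶜ y) := by
      rintro (h | h)
      · exact hze h.symm
      · exact connectedComponentIn_subset _ _ h rfl
    exact subset_connectedComponentIn_compl hp he (mem_insert_of_mem _ (mem_connectedComponentIn hy))
      (mem_connectedComponentIn hy) (mem_insert _ _)

/-- In a locally connected continuum, each component of the complement of a point contains a
point whose complement is connected. -/
theorem exists_isPreconnected_compl_singleton [CompactSpace X] {c x : X} (hx : x ≠ c) :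
    ∃ e ∈ connectedComponentIn {c}ᶜ x, IsPreconnected ({e}ᶜ : Set X) := by
  by_contra! hcon
  set P := connectedComponentIn {c}ᶜ x with hP
  have hcP : c ∉ P := fun h => connectedComponentIn_subset _ _ h rfl
  have hxP : x ∈ P := mem_connectedComponentIn hx
  have hcut : ∀ e ∈ P, ∃ y, y ≠ e ∧ c ∉ connectedComponentIn {e}ᶜ y := by
    intro e he
    by_contra! h
    refine hcon e he (isPreconnected_of_forall c fun y hy => ?_)
    exact ⟨_, connectedComponentIn_subset _ _, h y hy, mem_connectedComponentIn hy,
      isPreconnected_connectedComponentIn⟩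
  -- If every point of `P` cuts, each gives a component missing `c`. Cutting again at a point of a
  -- minimal such component gives a strictly smaller one.
  let S : Set (Set X) := {D | ∃ e ∈ P, ∃ y, y ≠ e ∧ D = connectedComponentIn {e}ᶜ y ∧ c ∉ D}
  have nest : ∀ {K : Set X} {e y : X}, IsPreconnected Kᶜ → c ∉ K → e ∈ K →
      c ∉ connectedComponentIn {e}ᶜ y → connectedComponentIn {e}ᶜ y ⊆ K := by
    intro K e y hK hcK heK hc w hw
    by_contra hwK
    exact hc (subset_connectedComponentIn_compl hK (fun h => h heK) hwK hw hcK)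
  obtain ⟨D, ⟨e, heP, y, hye, rfl, hcD⟩, hmin⟩ : ∃ D, Minimal (· ∈ S) D := by
    refine zorn_superset S fun 𝒞 h𝒞 hchain => ?_
    rcases 𝒞.eq_empty_or_nonempty with rfl | hne
    · obtain ⟨y, hy, hc⟩ := hcut x hxP
      exact ⟨_, ⟨x, hxP, y, hy, rfl, hc⟩, by simp⟩
    have hnon : (⋂ D : 𝒞, closure (D : Set X)).Nonempty := by
      have := hne.to_subtype
      refine IsCompact.nonempty_iInter_of_directed_nonempty_isCompact_isClosed _ ?_ ?_
        (fun D => isClosed_closure.isCompact) (fun D => isClosed_closure)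
      · intro F G
        rcases hchain.total F.2 G.2 with h | h
        · exact ⟨F, subset_rfl, closure_mono h⟩
        · exact ⟨G, closure_mono h, subset_rfl⟩
      · intro D
        obtain ⟨e, -, y, hy, hD, -⟩ := h𝒞 D.2
        exact ⟨y, subset_closure (hD ▸ mem_connectedComponentIn hy)⟩
    obtain ⟨p, hp⟩ := hnon
    have hp' : ∀ D ∈ 𝒞, p ∈ closure D := fun D hD => mem_iInter.1 hp ⟨D, hD⟩
    -- If `p` is in all members, a component cut off at `p` is a lower bound. If it is missing from
    -- `D`, then `p` is the cut point of `D` and of every smaller member; these are components of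
    -- the same set, so they equal `D`.
    by_cases hall : ∀ D ∈ 𝒞, p ∈ D
    · obtain ⟨D, hD⟩ := hne
      obtain ⟨e, he, y, hy, hDe, hc⟩ := h𝒞 hD
      have hpP : p ∈ P := nest (isPreconnected_compl_connectedComponentIn c x) hcP he (hDe ▸ hc)
        (hDe ▸ hall D hD)
      obtain ⟨q, hq, hcq⟩ := hcut p hpP
      refine ⟨_, ⟨p, hpP, q, hq, rfl, hcq⟩, fun F hF => ?_⟩
      obtain ⟨e', -, y', -, rfl, hc'⟩ := h𝒞 hF
      exact nest (isPreconnected_compl_connectedComponentIn e' y') hc' (hall _ hF) hcq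
    · push Not at hall
      obtain ⟨D, hD, hpD⟩ := hall
      refine ⟨D, h𝒞 hD, fun F hF => ?_⟩
      rcases hchain.total hD hF with h | h
      · exact h
      · have hpF : p ∉ F := fun h' => hpD (h h')
        have hpDc := hp' D hD
        have hpFc := hp' F hF
        obtain ⟨e, -, y, hy, rfl, -⟩ := h𝒞 hD
        obtain ⟨e', -, y', hy', rfl, -⟩ := h𝒞 hF
        rw [closure_connectedComponentIn_compl hy] at hpDc
        rw [closure_connectedComponentIn_compl hy'] at hpFc
        obtain rfl := hpDc.resolve_right hpD
        obtain rfl := hpFc.resolve_right hpF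
        rw [connectedComponentIn_eq (h (mem_connectedComponentIn hy'))]
  have hyD : y ∈ connectedComponentIn {e}ᶜ y := mem_connectedComponentIn hye
  have hyP : y ∈ P := nest (isPreconnected_compl_connectedComponentIn c x) hcP heP hcD hyD
  obtain ⟨z, hz, hcz⟩ := hcut y hyP
  have hsub := nest (isPreconnected_compl_connectedComponentIn e y) hcD hyD hcz
  exact connectedComponentIn_subset _ _
    (hmin ⟨y, hyP, z, hz, rfl, hcz⟩ hsub hyD) rfl

end Components

section Dendrite

variable {X : Type*} [MetricSpace X]

/-- A branch point of a dendrite separates three points of the whole dendrite pairwise. -/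
theorem IsDendrite.exists_separatedIn_of_mem_branchPoints (hX : IsDendrite X) {b : X}
    (hb : b ∈ branchPoints X) :
    ∃ x ∈ ({b}ᶜ : Set X), ∃ y ∈ ({b}ᶜ : Set X), ∃ z ∈ ({b}ᶜ : Set X),
      SeparatedIn {b}ᶜ x y ∧ SeparatedIn {b}ᶜ x z ∧ SeparatedIn {b}ᶜ y z := by
  obtain ⟨U, -, hUd, hcard⟩ := hb
  obtain ⟨x, hx, y, hy, z, hz, hxy, hxz, hyz⟩ := two_lt_card_connectedComponents_iff.1 hcard
  have := hUd.continuum.connected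
  have hU : IsPreconnected U := isPreconnected_iff_preconnectedSpace.2 inferInstance
  -- A connected set joining the points in the whole space has connected trace on `U`, by
  -- unicoherence.
  have hsep : ∀ {x y : X}, x ∈ U → y ∈ U → SeparatedIn (U \ {b}) x y → SeparatedIn {b}ᶜ x y :=
    fun hx hy h S hS hSp hxS hyS => h (S ∩ U) (fun w hw => ⟨hw.2, hS hw.1⟩)
      (hX.isPreconnected_inter hSp hU) ⟨hxS, hx⟩ ⟨hyS, hy⟩
  exact ⟨x, hx.2, y, hy.2, z, hz.2, hsep hx.1 hy.1 hxy, hsep hx.1 hz.1 hxz, hsep hy.1 hz.1 hyz⟩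

/-- A point separating two others is not an end point. -/
theorem IsDendrite.notMem_endPoints (hX : IsDendrite X) {b x y : X} (hx : x ≠ b) (hy : y ≠ b)
    (h : SeparatedIn {b}ᶜ x y) : b ∉ endPoints X := by
  have := hX.continuum.connected
  have := hX.locallyConnected
  rintro ⟨U, hU, -, hUb⟩
  have hmeet : ∀ {x : X}, x ≠ b → ∃ w ∈ connectedComponentIn {b}ᶜ x, w ∈ U \ {b} := by
    intro x hx
    obtain ⟨w, hwU, hw⟩ := mem_closure_iff_nhds.1 (mem_closure_connectedComponentIn_compl hx) U hU
    exact ⟨w, hw, hwU, connectedComponentIn_subset _ _ hw⟩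
  obtain ⟨u, hux, huU⟩ := hmeet hx
  obtain ⟨v, hvy, hvU⟩ := hmeet hy
  have hb : b ∉ U \ {b} := fun h => h.2 rfl
  have h1 := subset_connectedComponentIn_compl hUb hb huU hux hvU
  rw [separatedIn_iff hx, connectedComponentIn_eq h1, ← connectedComponentIn_eq hvy] at h
  exact h (mem_connectedComponentIn hy)

/-- For a branch point `c` and any other point `b`, two components of the complement of `c` that
do not contain `b` contain end points. -/
theorem IsDendrite.exists_endPoints_of_mem_branchPoints (hX : IsDendrite X) {b c : X}
    (hc : c ∈ branchPoints X) :
    ∃ e ∈ endPoints X, ∃ e' ∈ endPoints X, e ≠ c ∧ e' ≠ c ∧ b ∉ connectedComponentIn {c}ᶜ e ∧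
      b ∉ connectedComponentIn {c}ᶜ e' ∧ e' ∉ connectedComponentIn {c}ᶜ e := by
  have := hX.continuum.connected
  have := hX.continuum.compact
  have := hX.locallyConnected
  obtain ⟨x, hx, y, hy, z, hz, hxy, hxz, hyz⟩ := hX.exists_separatedIn_of_mem_branchPoints hc
  have key : ∀ {x y : X}, x ∈ ({c}ᶜ : Set X) → y ∈ ({c}ᶜ : Set X) → SeparatedIn {c}ᶜ x y →
      b ∉ connectedComponentIn {c}ᶜ x → b ∉ connectedComponentIn {c}ᶜ y →
      ∃ e ∈ endPoints X, ∃ e' ∈ endPoints X, e ≠ c ∧ e' ≠ c ∧ b ∉ connectedComponentIn {c}ᶜ e ∧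
      b ∉ connectedComponentIn {c}ᶜ e' ∧ e' ∉ connectedComponentIn {c}ᶜ e := by
    intro x y hx hy hxy hbx hby
    obtain ⟨e, he, hep⟩ := exists_isPreconnected_compl_singleton (c := c) (x := x) hx
    obtain ⟨e', he', hep'⟩ := exists_isPreconnected_compl_singleton (c := c) (x := y) hy
    have hend : ∀ {e : X}, IsPreconnected ({e}ᶜ : Set X) → e ∈ endPoints X := fun h =>
      ⟨Set.univ, univ_mem, hX.univ, by rwa [← compl_eq_univ_sdiff]⟩
    refine ⟨e, hend hep, e', hend hep', connectedComponentIn_subset _ _ he,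
      connectedComponentIn_subset _ _ he', ?_, ?_, ?_⟩
    · rwa [← connectedComponentIn_eq he]
    · rwa [← connectedComponentIn_eq he']
    · rw [← connectedComponentIn_eq he]
      intro h
      rw [separatedIn_iff hx, connectedComponentIn_eq h, ← connectedComponentIn_eq he'] at hxy
      exact hxy (mem_connectedComponentIn hy)
  have excl : ∀ {x y : X}, x ∈ ({c}ᶜ : Set X) → y ∈ ({c}ᶜ : Set X) → SeparatedIn {c}ᶜ x y →
      b ∈ connectedComponentIn {c}ᶜ x → b ∉ connectedComponentIn {c}ᶜ y := by
    intro x y hx hy hxy hbx hby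
    rw [separatedIn_iff hx, connectedComponentIn_eq hbx, ← connectedComponentIn_eq hby] at hxy
    exact hxy (mem_connectedComponentIn hy)
  -- At most one of the three components contains `b`; end points are taken in two others.
  by_cases hbx : b ∈ connectedComponentIn {c}ᶜ x
  · exact key hy hz hyz (excl hx hy hxy hbx) (excl hx hz hxz hbx)
  · by_cases hby : b ∈ connectedComponentIn {c}ᶜ y
    · exact key hx hz hxz hbx (excl hy hz hyz hby)
    · exact key hx hy hxy hbx hby

/-- A point `b` cannot be cut off from each of `p`, `p'` by two points `c ≠ d` each of which
separates `p` from `p'`. -/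
theorem not_separated_twice [PreconnectedSpace X] [LocallyConnectedSpace X] {b p p' c d : X}
    (hcd : c ≠ d) (hpc : p ≠ c) (hpd : p ≠ d) (hpc' : p' ≠ c) (hpd' : p' ≠ d)
    (hbc : b ∉ connectedComponentIn {c}ᶜ p) (hbc' : b ∉ connectedComponentIn {c}ᶜ p')
    (hbd : b ∉ connectedComponentIn {d}ᶜ p) (hbd' : b ∉ connectedComponentIn {d}ᶜ p')
    (hc : p' ∉ connectedComponentIn {c}ᶜ p) (hd : p' ∉ connectedComponentIn {d}ᶜ p) : False := by
  have hor : ∀ {p : X}, p ≠ c → p ≠ d → d ∈ connectedComponentIn {c}ᶜ p ∨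
      c ∈ connectedComponentIn {d}ᶜ p := by
    intro p hpc hpd
    -- Otherwise the closure of the component of `p` off `c` joins `p` to `c` without meeting `d`.
    by_contra! h
    have hK : IsPreconnected (insert c (connectedComponentIn {c}ᶜ p)) := by
      rw [← closure_connectedComponentIn_compl hpc]
      exact isPreconnected_connectedComponentIn.closure
    refine h.2 (subset_connectedComponentIn_compl hK ?_
      (mem_insert_of_mem _ (mem_connectedComponentIn hpc)) (mem_connectedComponentIn hpd)
      (mem_insert _ _))
    rintro (h' | h')
    · exact hcd h'.symm
    · exact h.1 h'
  have hdisj : ∀ {c d : X}, p' ≠ c → p' ∉ connectedComponentIn {c}ᶜ p →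
      d ∈ connectedComponentIn {c}ᶜ p → d ∉ connectedComponentIn {c}ᶜ p' := by
    intro c d hpc' hc h h'
    rw [connectedComponentIn_eq h, ← connectedComponentIn_eq h'] at hc
    exact hc (mem_connectedComponentIn hpc')
  rcases hor hpc hpd with h | h
  -- Now `c` lies on the side of `p'` off `d`. The complement of the side of `p` off `c` is
  -- connected, contains `c` and `b`, and avoids `d`, which puts `b` on that side too.
  · have h2 := (hor hpc' hpd').resolve_left (hdisj hpc' hc h)
    exact hbd' (subset_connectedComponentIn_compl (isPreconnected_compl_connectedComponentIn c p)
      (fun h' => h' h) (fun h' => connectedComponentIn_subset _ _ h' rfl) h2 hbc)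
  · have h2 := (hor hpc' hpd').resolve_right (hdisj hpd' hd h)
    exact hbc' (subset_connectedComponentIn_compl (isPreconnected_compl_connectedComponentIn d p)
      (fun h' => h' h) (fun h' => connectedComponentIn_subset _ _ h' rfl) h2 hbd)

/-- A dendrite with a closed set of end points has a discrete set of branch points. -/
theorem IsDendrite.isDiscrete_branchPoints (hX : IsDendrite X) (hE : IsClosed (endPoints X)) :
    IsDiscrete (branchPoints X) := by
  have := hX.continuum.connected
  have := hX.continuum.compact
  have := hX.locallyConnected
  rw [isDiscrete_iff_discreteTopology, discreteTopology_subtype_iff]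
  intro b hb
  by_contra hne
  have hneBot : (𝓝[≠] b ⊓ 𝓟 (branchPoints X)).NeBot := ⟨hne⟩
  -- Along an ultrafilter, arbitrary choices of end points converge by compactness.
  set 𝒰 := Ultrafilter.of (𝓝[≠] b ⊓ 𝓟 (branchPoints X)) with h𝒰
  have hle : (𝒰 : Filter X) ≤ 𝓝[≠] b ⊓ 𝓟 (branchPoints X) := Ultrafilter.of_le _
  have hB : ∀ᶠ c in (𝒰 : Filter X), c ∈ branchPoints X :=
    (hle.trans inf_le_right) (mem_principal_self _)
  have hnhds : (𝒰 : Filter X) ≤ 𝓝 b := (hle.trans inf_le_left).trans nhdsWithin_le_nhds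
  have hneb : ∀ᶠ c in (𝒰 : Filter X), c ≠ b := (hle.trans inf_le_left) self_mem_nhdsWithin
  have hb_end : b ∉ endPoints X := by
    obtain ⟨x, hx, y, hy, -, -, hxy, -⟩ := hX.exists_separatedIn_of_mem_branchPoints hb
    exact hX.notMem_endPoints hx hy hxy
  have hex : ∀ c, ∃ e e' : X, c ∈ branchPoints X → e ∈ endPoints X ∧ e' ∈ endPoints X ∧ e ≠ c ∧
      e' ≠ c ∧ b ∉ connectedComponentIn {c}ᶜ e ∧ b ∉ connectedComponentIn {c}ᶜ e' ∧
      e' ∉ connectedComponentIn {c}ᶜ e := by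
    intro c
    by_cases hc : c ∈ branchPoints X
    · obtain ⟨e, he, e', he', h⟩ := hX.exists_endPoints_of_mem_branchPoints (b := b) hc
      exact ⟨e, e', fun _ => ⟨he, he', h⟩⟩
    · exact ⟨c, c, fun h => absurd h hc⟩
  choose e e' hee using hex
  have hlim : ∀ e : X → X, (∀ᶠ c in (𝒰 : Filter X), e c ∈ endPoints X) →
      ∃ p, ∀ᶠ c in (𝒰 : Filter X), p ≠ c ∧ p ∈ connectedComponentIn {c}ᶜ (e c) := by
    intro e he
    set p := (𝒰.map e).lim with hp
    have hpl : Tendsto e 𝒰 (𝓝 p) := (𝒰.map e).le_nhds_lim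
    have hpE : p ∈ endPoints X := hE.mem_of_tendsto hpl he
    have hpb : p ≠ b := fun h => hb_end (h ▸ hpE)
    -- The limit `p` is an end point, hence not `b`. A connected neighbourhood of `p` misses all `c`
    -- near `b`, so it lies on the same side of `c` as `e c`.
    obtain ⟨A, A', hA, hA', hpA, hbA', hAA'⟩ := t2_separation hpb
    have hN : IsOpen (connectedComponentIn A p) := hA.connectedComponentIn
    refine ⟨p, ?_⟩
    filter_upwards [hnhds (hA'.mem_nhds hbA'),
      hpl (hN.mem_nhds (mem_connectedComponentIn hpA))] with c hcA' hce
    have hcN : c ∉ connectedComponentIn A p := fun h =>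
      disjoint_left.1 hAA' (connectedComponentIn_subset _ _ h) hcA'
    refine ⟨fun h => hcN (h ▸ mem_connectedComponentIn hpA), ?_⟩
    exact subset_connectedComponentIn_compl isPreconnected_connectedComponentIn hcN hce
      (mem_connectedComponentIn fun h => hcN (mem_singleton_iff.1 h ▸ hce))
      (mem_connectedComponentIn hpA)
  obtain ⟨p, hp⟩ := hlim e (hB.mono fun c hc => (hee c hc).1)
  obtain ⟨p', hp'⟩ := hlim e' (hB.mono fun c hc => (hee c hc).2.1)
  have hev : ∀ᶠ c in (𝒰 : Filter X), p ≠ c ∧ p' ≠ c ∧ b ∉ connectedComponentIn {c}ᶜ p ∧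
      b ∉ connectedComponentIn {c}ᶜ p' ∧ p' ∉ connectedComponentIn {c}ᶜ p := by
    filter_upwards [hB, hp, hp'] with c hc hpc hpc'
    obtain ⟨-, -, h1, h2, h3, h4, h5⟩ := hee c hc
    refine ⟨hpc.1, hpc'.1, ?_, ?_, ?_⟩
    · rwa [← connectedComponentIn_eq hpc.2]
    · rwa [← connectedComponentIn_eq hpc'.2]
    · rw [← connectedComponentIn_eq hpc.2]
      intro h
      rw [connectedComponentIn_eq h, ← connectedComponentIn_eq hpc'.2] at h5
      exact h5 (mem_connectedComponentIn h2)
  obtain ⟨c, hc, hcb⟩ := (hev.and hneb).exists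
  have hnec : ∀ᶠ d in (𝒰 : Filter X), d ≠ c :=
    hnhds (isOpen_compl_singleton.mem_nhds (Ne.symm hcb))
  obtain ⟨d, hd, hdc⟩ := (hev.and hnec).exists
  exact not_separated_twice (Ne.symm hdc) hc.1 hd.1 hc.2.1 hd.2.1 hc.2.2.1 hc.2.2.2.1 hd.2.2.1
    hd.2.2.2.1 hc.2.2.2.2 hd.2.2.2.2

end Dendrite

end OmegaFTP

theorem mainTheorem6 {X : Type*} [MetricSpace X] :
    (OmegaFTP.IsLocalDendrite X → IsDiscrete (OmegaFTP.branchPoints X) →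
      OmegaFTP.HasOmegaFTP X) ∧
    (OmegaFTP.IsGraph X → OmegaFTP.HasOmegaFTP X) ∧
    (OmegaFTP.IsDendrite X → IsDiscrete (OmegaFTP.branchPoints X) → OmegaFTP.HasOmegaFTP X) ∧
    (OmegaFTP.IsDendrite X → IsClosed (OmegaFTP.endPoints X) →
      IsDiscrete (OmegaFTP.branchPoints X) ∧ OmegaFTP.HasOmegaFTP X) := by
  have key : OmegaFTP.IsLocalDendrite X → IsDiscrete (OmegaFTP.branchPoints X) →
      OmegaFTP.HasOmegaFTP X := fun hX hB =>
    have := hX.continuum.compact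
    (hX.fatSubcontinua hB).hasOmegaFTP
  refine ⟨key, fun hX => ?_, fun hX => key hX.isLocalDendrite, fun hX hE => ?_⟩
  · have := hX.continuum.compact
    exact hX.fatSubcontinua.hasOmegaFTP
  · have hB := hX.isDiscrete_branchPoints hE
    exact ⟨hB, key hX.isLocalDendrite hB⟩
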